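/- **Definitions.** A sequence $\mathbb M=(M_p)_{p\ge0}$ of positive reals with $M_0=1$ is *strongly regular* if $M_p^2\le M_{p-1}M_{p+1}$ for $p\ge1$; $M_{p+q}\le A_1^{p+q}M_pM_q$ for all $p,q\ge0$ and some $A_1>0$; and $\sum_{q\ge p}\frac{M_q}{(q+1)M_{q+1}}\le A_2\frac{M_p}{M_{p+1}}$ for all $p\ge 0$ and some $A_2>0$. Put $M(t)=\sup_{p\ge0}\log(t^p/M_p)$ for $t>0$, $M(0)=0$, and $\omega(\mathbb M)=\big(\limsup_{r\to\infty}\max\{0,\tfrac{\log M(r)}{\log r}\}\big)^{-1}\in(0,\infty)$. The sequence $\mathbb M$ *admits a nonzero proximate order* if there is a continuous, piecewise continuously differentiable $\rho:(c,\infty)\to[0,\infty)$ with $\rho(t)\to L\in(0,\infty)$ and $t\rho'(t)\log t\to0$ as $t\to\infty$, such that $\log t\,\big(\rho(t)-\frac{\log M(t)}{\log t}\big)$ is bounded for large $t$. Let $S_d(\theta)$ be the open infinite sector with vertex $0$, bisecting direction $d$ and opening $\theta$, and $\hat S_d(\theta;r)=S_d(\theta)\cup D(0,r)$. For a complex Banach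 space $\mathbb E$, $\mathcal O^{\mathbb M}(\hat S_d(\theta;r),\mathbb E)$ is the set of holomorphic $f:\hat S_d(\theta;r)\to\mathbb E$ such that for all $0<\theta'<\theta$, $0<r'<r$ there are $c,k>0$ with $\|f(z)\|\le c\,e^{M(|z|/k)}$ on $\hat S_d(\theta';r')$. If $\omega(\mathbb M)<2$, *kernel functions for $\mathbb M$-summability* are functions $e,E$ such that: 1. $e$ is holomorphic on $S_0(\omega(\mathbb M)\pi)$ and real on $(0,\infty)$; there is $t_0>0$ such that every $z_0\in S_0(\omega(\mathbb M)\pi)$ has a neighbourhood $U\subseteq S_0(\omega(\mathbb M)\pi)$ with $\int_0^{t_0}\sup_{z\in U}|e(t/z)|\frac{dt}{t}<\infty$; and for every $\epsilon>0$ there are $c,k>0$ with $|e(z)|\le c\,e^{-M(|z|/k)}$ on $S_0(\omega(\mathbb M)\pi-\epsilon)$. 2. $E$ is entire with $|E(z)|\le\tilde c\,e^{M(|z|/\tilde k)}$ for some $\tilde c,\tilde k>0$, and there is $\beta>0$ such that for all $0<\tilde\theta<2\pi-\omega(\mathbb M)\pi$ and $R>0$ there is $\tilde c_2>0$ with $|E(z)|\le\tilde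 c_2|z|^{-\beta}$ on $S_\pi(\tilde\theta)\setminus D(0,R)$. 3. $m_e(z)=\int_0^\infty t^{z-1}e(t)\,dt$ converges and is continuous on $\operatorname{Re}z\ge0$ and holomorphic on $\operatorname{Re}z>0$; $m_e(p)\neq0$ for all integers $p\ge0$, and $E(z)=\sum_{p\ge0}z^p/m_e(p)$ for all $z\in\mathbb C$. The sequence $(m_e(p))_{p\ge0}$ is the *sequence of moments* of $e$. For arbitrary $\omega(\mathbb M)$, kernels are obtained by ramification: if $q\ge1$ is an integer with $\omega(\mathbb M)<2q$ and $(e,E)$ are kernel functions for summability with respect to $(M_p^{1/q})_p$, then $z\mapsto e(z^{1/q})/q$ is a kernel for $\mathbb M$-summability, with sequence of moments $(m_e(qp))_{p\ge0}$ (the case $q=1$ is the previous one). A *sequence of moments* is the sequence of moments of a kernel for $\mathbb M$-summability for some strongly regular $\mathbb M$. For a sequence of moments $m$, define on $\mathbb E[[z]]$ the operators $$\hat{\mathcal B}_{m}\Big(\sum_{p\ge0} a_pz^p\Big)=\sum_{p\ge0}\frac{a_p}{m(p)}z^p,\qquad \partial_{m,z}\Big(\sum_{p\ge0}\frac{u_p}{m(p)}z^p\Big)=\sum_{p\ge0}\frac{u_{p+1}}{m(p)}z^p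 .$$ If $m$ is the sequence of moments of a kernel for $\mathbb M$-summability, let $\mathbb E\{z\}_{m,d}$ be the set of $\hat u\in\mathbb E[[z]]$ such that $\hat{\mathcal B}_{m}\hat u$ converges near $0$ and extends to an element of $\mathcal O^{\mathbb M}(\hat S_d(\theta;r),\mathbb E)$ for some $\theta,r>0$. The space $\mathbb E\{z\}_{\mathbb M,d}$ of *$\mathbb M$-summable series in direction $d$* consists of the series belonging to $\mathbb E\{z\}_{m,d}$ for some such $m$. **Corollary.** Let $\mathbb E$ be a complex Banach space, $m_e$ a sequence of moments, $\tilde{\mathbb M}$ a strongly regular sequence admitting a nonzero proximate order, and $d\in\mathbb R$. Then $\mathbb E\{z\}_{\tilde{\mathbb M},d}$ is closed under $\partial_{m_e,z}$: if $\hat f\in\mathbb E\{z\}_{\tilde{\mathbb M},d}$, then $\partial_{m_e,z}\hat f\in\mathbb E\{z\}_{\tilde{\mathbb M},d}$. The same holds for $\mathbb E\{z\}_{\tilde m,d}$, for the sequence of moments $\tilde m$ of each single kernel for $\tilde{\mathbb M}$-summability. -/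

import Mathlib

namespace MomentSummability

open Filter Topology MeasureTheory

/-! ### Strongly regular sequences -/

/-- Strongly regular sequences: positive, `M 0 = 1`, logarithmically convex (lc), of moderate
growth (mg) and strongly non-quasianalytic (snq). -/
structure StronglyRegular (M : ℕ → ℝ) : Prop where
  pos : ∀ p, 0 < M p
  zero : M 0 = 1
  lc : ∀ p, M (p + 1) ^ 2 ≤ M p * M (p + 2)
  mg : ∃ A : ℝ, 0 < A ∧ ∀ p q, M (p + q) ≤ A ^ (p + q) * M p * M q
  snq : ∃ A : ℝ, 0 < A ∧ ∀ p : ℕ,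
    Summable (fun j : ℕ => M (p + j) / (((p + j : ℕ) + 1 : ℝ) * M (p + j + 1))) ∧
    ∑' j : ℕ, M (p + j) / (((p + j : ℕ) + 1 : ℝ) * M (p + j + 1)) ≤ A * (M p / M (p + 1))

/-- The associated function `M(t) = sup_p log (t ^ p / M_p)`, used for `t ≥ 0`. For a strongly
regular sequence the supremum is finite, and at `t = 0` it is `0`
(see `assocFun_zero`). -/
noncomputable def assocFun (M : ℕ → ℝ) (t : ℝ) : ℝ :=
  ⨆ p : ℕ, Real.log (t ^ p / M p)

theorem assocFun_zero {M : ℕ → ℝ} (hM : StronglyRegular M) : assocFun M 0 = 0 := by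
  have h : (fun p : ℕ => Real.log ((0 : ℝ) ^ p / M p)) = fun _ => 0 := by
    funext p
    rcases p with _ | p
    · simp [hM.zero]
    · simp
  simp only [assocFun, h, ciSup_const]

/-- The order `limsup_{r → ∞} max (0, log M(r) / log r)` of the associated function
(`ENNReal.ofReal x` is `max 0 x`, and the limsup is taken in `[0, ∞]`). -/
noncomputable def order (M : ℕ → ℝ) : ENNReal :=
  limsup (fun r : ℝ => ENNReal.ofReal (Real.log (assocFun M r) / Real.log r)) atTop

/-- The index `ω(M) = 1 / order`; for strongly regular sequences the order is a positive
real number. -/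
noncomputable def omega (M : ℕ → ℝ) : ℝ := (order M)⁻¹.toReal

/-- A nonzero proximate order on `(c, ∞)`: a nonnegative continuous function, continuously
differentiable off a set `S` of exceptional points with finitely many points in each `(c, b]`, at
which finite lateral derivatives exist, that has a positive finite limit at infinity and satisfies
`t ρ'(t) log t → 0`. -/
def IsNonzeroProximateOrder (ρ : ℝ → ℝ) : Prop :=
  ∃ (c : ℝ) (S : Set ℝ), ContinuousOn ρ (Set.Ioi c) ∧
    (∀ b, (S ∩ Set.Ioc c b).Finite) ∧
    (∀ t ∈ Set.Ioi c \ S, ContDiffAt ℝ 1 ρ t) ∧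
    (∀ t ∈ Set.Ioi c ∩ S, ∃ l r : ℝ,
      HasDerivWithinAt ρ l (Set.Iic t) t ∧ HasDerivWithinAt ρ r (Set.Ici t) t) ∧
    (∀ t ∈ Set.Ioi c, 0 ≤ ρ t) ∧
    (∃ L : ℝ, 0 < L ∧ Tendsto ρ atTop (𝓝 L)) ∧
    Tendsto (fun t => t * deriv ρ t * Real.log t) (atTop ⊓ 𝓟 Sᶜ) (𝓝 0)

/-- `M` admits a nonzero proximate order: `log t * (ρ(t) - log M(t) / log t)` is bounded near
infinity for some nonzero proximate order `ρ`. -/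
def AdmitsNonzeroProximateOrder (M : ℕ → ℝ) : Prop :=
  ∃ ρ : ℝ → ℝ, IsNonzeroProximateOrder ρ ∧ ∃ A B : ℝ, ∀ᶠ t : ℝ in atTop,
    A ≤ Real.log t * (ρ t - Real.log (assocFun M t) / Real.log t) ∧
    Real.log t * (ρ t - Real.log (assocFun M t) / Real.log t) ≤ B

/-! ### Sectors and functions of controlled growth -/

/-- The open infinite sector with bisecting direction `d` and opening `θ`, as a subset of the
plane (used for `θ ≤ 2π`, where it is the projection of the sector in the Riemann surface of the
logarithm; it is empty for `θ ≤ 0`). -/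
def sector (d θ : ℝ) : Set ℂ :=
  {z | z ≠ 0 ∧ |(z * Complex.exp (-(d * Complex.I))).arg| < θ / 2}

/-- The union of the sector and the open disc of radius `r` about the origin. -/
def hatSector (d θ r : ℝ) : Set ℂ := sector d θ ∪ Metric.ball 0 r

/-- The space `O^M(Ŝ_d(θ; r), F)`. -/
def IsOfGrowth {F : Type*} [NormedAddCommGroup F] [NormedSpace ℂ F]
    (M : ℕ → ℝ) (d θ r : ℝ) (f : ℂ → F) : Prop :=
  DifferentiableOn ℂ f (hatSector d θ r) ∧
    ∀ θ' r' : ℝ, 0 < θ' → θ' < θ → 0 < r' → r' < r →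
      ∃ c k : ℝ, 0 < c ∧ 0 < k ∧
        ∀ z ∈ hatSector d θ' r', ‖f z‖ ≤ c * Real.exp (assocFun M (‖z‖ / k))

/-! ### Kernel functions and sequences of moments -/

/-- The moment function `m_e(z) = ∫_0^∞ t ^ (z - 1) e(t) dt`. -/
noncomputable def momentFun (e : ℂ → ℂ) (z : ℂ) : ℂ := mellin (fun t : ℝ => e t) z

/-- Kernel functions `e`, `E` for `M`-summability, for a sequence with `ω(M) < 2`. -/
structure IsKernelPair (M : ℕ → ℝ) (e E : ℂ → ℂ) : Prop where
  omega_lt_two : omega M < 2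
  e_holo : DifferentiableOn ℂ e (sector 0 (omega M * Real.pi))
  /-- `e(z) / z` is locally uniformly integrable at the origin. -/
  e_integrable : ∃ t₀ : ℝ, 0 < t₀ ∧ ∀ z₀ ∈ sector 0 (omega M * Real.pi),
    ∃ U : Set ℂ, IsOpen U ∧ z₀ ∈ U ∧ U ⊆ sector 0 (omega M * Real.pi) ∧
      ∫⁻ t in Set.Ioc 0 t₀, (⨆ z ∈ U, ‖e ((t : ℂ) / z)‖ₑ) / ENNReal.ofReal t < ⊤
  e_decay : ∀ ε : ℝ, 0 < ε → ∃ c k : ℝ, 0 < c ∧ 0 < k ∧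
    ∀ z ∈ sector 0 (omega M * Real.pi - ε), ‖e z‖ ≤ c * Real.exp (-assocFun M (‖z‖ / k))
  e_real : ∀ x : ℝ, 0 < x → (e x).im = 0
  E_entire : Differentiable ℂ E
  E_growth : ∃ c k : ℝ, 0 < c ∧ 0 < k ∧ ∀ z, ‖E z‖ ≤ c * Real.exp (assocFun M (‖z‖ / k))
  E_decay : ∃ β : ℝ, 0 < β ∧ ∀ θ : ℝ, 0 < θ → θ < 2 * Real.pi - omega M * Real.pi →
    ∀ R : ℝ, 0 < R → ∃ c : ℝ, 0 < c ∧
      ∀ z ∈ sector Real.pi θ \ Metric.ball 0 R, ‖E z‖ ≤ c / ‖z‖ ^ β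
  moment_conv : ∀ z : ℂ, 0 ≤ z.re → MellinConvergent (fun t : ℝ => e t) z
  moment_cont : ContinuousOn (momentFun e) {z | 0 ≤ z.re}
  moment_holo : DifferentiableOn ℂ (momentFun e) {z | 0 < z.re}
  /-- The moments do not vanish, so that the expansion of `E` makes sense. -/
  moment_ne_zero : ∀ p : ℕ, momentFun e p ≠ 0
  E_series : ∀ z : ℂ, HasSum (fun p : ℕ => z ^ p / momentFun e p) (E z)

/-- `m` is the sequence of moments of a kernel for `M`-summability. For `q = 1` (which requires
`ω(M) < 2`) this says `m p = m_e(p)` for a kernel `e` for `M`-summability. A ramification index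
`q ≥ 2` covers `ω(M) ≥ 2`: the kernel for `M`-summability is then `z ↦ e(z ^ (1/q)) / q`, where
`e` is a kernel for summability with respect to `(M_p ^ (1/q))_p`, a sequence of index `ω(M) / q`,
and its moments are `m_e(q p)`. -/
def IsMomentSequenceFor (M : ℕ → ℝ) (m : ℕ → ℂ) : Prop :=
  ∃ (q : ℕ) (e E : ℂ → ℂ), 1 ≤ q ∧ IsKernelPair (fun p => M p ^ (1 / q : ℝ)) e E ∧
    ∀ p : ℕ, m p = momentFun e ((q : ℂ) * (p : ℂ))

/-- A sequence of moments: the moments of a kernel for summability with respect to some strongly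
regular sequence. -/
def IsMomentSequence (m : ℕ → ℂ) : Prop :=
  ∃ M : ℕ → ℝ, StronglyRegular M ∧ IsMomentSequenceFor M m

/-! ### Formal power series, Borel transform, moment differentiation

A formal power series `∑ a_p z^p` with coefficients in `F` is given by its coefficients
`a : ℕ → F`. -/

/-- The formal `m`-moment Borel transform `∑ a_p z^p ↦ ∑ (a_p / m(p)) z^p`. -/
noncomputable def borel {F : Type*} [NormedAddCommGroup F] [NormedSpace ℂ F]
    (m : ℕ → ℂ) (a : ℕ → F) : ℕ → F :=
  fun p => (m p)⁻¹ • a p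

/-- Moment differentiation: `∑ (u_p / m(p)) z^p ↦ ∑ (u_{p+1} / m(p)) z^p`
(see `momentDeriv_borel`). -/
noncomputable def momentDeriv {F : Type*} [NormedAddCommGroup F] [NormedSpace ℂ F]
    (m : ℕ → ℂ) (a : ℕ → F) : ℕ → F :=
  fun p => (m p)⁻¹ • (m (p + 1) • a (p + 1))

theorem momentDeriv_borel {F : Type*} [NormedAddCommGroup F] [NormedSpace ℂ F]
    {m : ℕ → ℂ} (hm : ∀ p, m p ≠ 0) (u : ℕ → F) :
    momentDeriv m (fun p => (m p)⁻¹ • u p) = fun p => (m p)⁻¹ • u (p + 1) := by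
  funext p
  simp [momentDeriv, smul_smul, mul_inv_cancel₀ (hm (p + 1))]

/-! ### Summable formal power series -/

/-- The series whose formal `m`-moment Borel transform converges near the origin and extends to
an element of `O^M(Ŝ_d(θ; r), F)` for some opening `θ` and radius `r`. For `m` a sequence of
moments of a kernel for `M`-summability this is the space `F{z}_{m,d}`. -/
def summableSeriesWith (F : Type*) [NormedAddCommGroup F] [NormedSpace ℂ F]
    (M : ℕ → ℝ) (m : ℕ → ℂ) (d : ℝ) : Set (ℕ → F) :=
  {a | ∃ (θ r : ℝ) (g : ℂ → F), 0 < θ ∧ θ ≤ 2 * Real.pi ∧ 0 < r ∧ IsOfGrowth M d θ r g ∧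
    ∀ᶠ z : ℂ in 𝓝 0, HasSum (fun p : ℕ => z ^ p • borel m a p) (g z)}

/-- The space `F{z}_{M,d}` of `M`-summable series in direction `d`: the series that are summable
through some kernel for `M`-summability. -/
def summableSeries (F : Type*) [NormedAddCommGroup F] [NormedSpace ℂ F]
    (M : ℕ → ℝ) (d : ℝ) : Set (ℕ → F) :=
  {a | ∃ m : ℕ → ℂ, IsMomentSequenceFor M m ∧ a ∈ summableSeriesWith F M m d}

end MomentSummability

namespace MomentSummability

open Filter Topology MeasureTheory

/-! ### Weight sequences -/

/-! Write `b = borel m' a`. The `m'`-Borel transform of the `m`-derivative of `a` has `p`-th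
coefficient `(m(p+1)/m(p)) * (m'(p+1)/m'(p)) * b (p+1)`. So it suffices that the growth class on a
sector with a disc is stable, up to shrinking, under the shift of Taylor coefficients and under
multiplication by `h p = m(p+1)/m(p)`, for any sequence of moments. The weight attached to `m` never
has to be compared with `M`.

Multiplication of coefficients by `h`, with a shift by `n`, is the Hadamard convolution `f(z) =
(2πi)⁻¹ ∮ K(z/w) w⁻ⁿ g(w) dw/w` with `K(x) = ∑ h_j x^j`. Suppose `K` continues to the plane slit
along the positive axis, with bounds on closed subsectors (`ExtendsToSlitPlane`). Then the circle
can be opened into a keyhole which runs out inside the sector of `g` to a radius comparable to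
`|z|`. On it `z/w` is either small or away from the positive axis, so `K(z/w)` is bounded and `f`
grows like `g` at a comparable radius, up to a logarithmic factor that moderate growth absorbs
(`IsOfGrowth.exists_hadamard`).

The continuation of `K` comes from the kernels. Without ramification `K(x) = ∫ E(xt) e(t) dt` for
small `x` off the positive axis. Put `x = -exp v` with `|Im v| < π`, `κ = ω/2`, and replace `t` by
`t exp(-κ v)`. Then `E` is evaluated at `-t exp((1-κ)v)`, in the sector where it is bounded, and `e`
at `t exp(-κ v)`, in the sector where it decays. The two openings add up exactly to the strip `|Im
v| < π` (`exists_norm_stripIntegrand_le`, `exists_norm_stripKernel_le`,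
`exists_hasSum_stripKernel`). For ramification index `q` the same argument treats `m_e(j+q)/m_e(j)`,
and averaging over `q`-th roots extracts the exponents divisible by `q`
(`IsMomentSequenceFor.extendsToSlitPlane`). -/

/-- The properties of a strongly regular sequence that are stable under taking positive powers. -/
structure RegularWeight (M : ℕ → ℝ) : Prop where
  pos : ∀ p, 0 < M p
  zero : M 0 = 1
  lc : ∀ p, M (p + 1) ^ 2 ≤ M p * M (p + 2)
  mg : ∃ A : ℝ, 1 ≤ A ∧ ∀ p q, M (p + q) ≤ A ^ (p + q) * M p * M q
  summable_rpow : ∃ a : ℝ, 0 < a ∧ Summable fun p : ℕ => (M p / M (p + 1)) ^ a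

theorem antitone_ratio {M : ℕ → ℝ} (hpos : ∀ p, 0 < M p)
    (hlc : ∀ p, M (p + 1) ^ 2 ≤ M p * M (p + 2)) : Antitone fun p => M p / M (p + 1) := by
  refine antitone_nat_of_succ_le fun p => ?_
  rw [div_le_div_iff₀ (hpos _) (hpos _)]
  nlinarith [hlc p]

theorem half_le_sum_Ico_inv (p : ℕ) (hp : 1 ≤ p) :
    (1 / 2 : ℝ) ≤ ∑ j ∈ Finset.Ico p (2 * p), (1 : ℝ) / (j + 1) := by
  have hp' : (0 : ℝ) < p := by exact_mod_cast hp
  have : ∀ j ∈ Finset.Ico p (2 * p), (1 : ℝ) / (2 * p) ≤ 1 / (j + 1) := by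
    intro j hj
    rw [Finset.mem_Ico] at hj
    have : (j : ℝ) + 1 ≤ 2 * p := by exact_mod_cast hj.2
    exact one_div_le_one_div_of_le (by positivity) this
  refine le_trans ?_ (Finset.card_nsmul_le_sum _ _ _ this)
  simp only [Nat.card_Ico, nsmul_eq_mul]
  rw [show 2 * p - p = p by omega]
  field_simp
  exact le_rfl

/-- Each of the `k` dyadic blocks contributes at least one half. -/
theorem half_mul_le_sum_Ico_inv (p : ℕ) (hp : 1 ≤ p) (k : ℕ) :
    (k / 2 : ℝ) ≤ ∑ j ∈ Finset.Ico p (2 ^ k * p), (1 : ℝ) / (j + 1) := by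
  induction k with
  | zero => simp
  | succ k ih =>
    have h1 : 1 ≤ 2 ^ k * p := Nat.one_le_iff_ne_zero.2 (by positivity)
    rw [← Finset.sum_Ico_consecutive _ (Nat.le_mul_of_pos_left p (by positivity) : p ≤ 2 ^ k * p)
      (by rw [pow_succ]; nlinarith : 2 ^ k * p ≤ 2 ^ (k + 1) * p)]
    have h2 := half_le_sum_Ico_inv (2 ^ k * p) h1
    rw [show 2 * (2 ^ k * p) = 2 ^ (k + 1) * p by ring] at h2
    push_cast
    linarith

/-- Geometric decay of the ratios along a geometric progression of indices. -/
theorem StronglyRegular.exists_ratio_le_half {M : ℕ → ℝ} (hM : StronglyRegular M) :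
    ∃ k : ℕ, 1 ≤ k ∧ ∀ p, 1 ≤ p →
      M (2 ^ k * p) / M (2 ^ k * p + 1) ≤ (M p / M (p + 1)) / 2 := by
  obtain ⟨A, hA, h⟩ := hM.snq
  have hanti := antitone_ratio hM.pos hM.lc
  have hν : ∀ p, 0 < M p / M (p + 1) := fun p => div_pos (hM.pos _) (hM.pos _)
  -- The ratios decrease, so the snq sum over `[p, 2^k p)` is at least `k/2` times the last ratio.
  -- Comparison with `A` times the first one gives the factor `2A/k`, which is at most `1/2` once `k
  -- ≥ 4A`.
  obtain ⟨k, hk⟩ := exists_nat_ge (4 * A + 1)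
  have hk0 : (0 : ℝ) < k := by linarith
  refine ⟨k, by exact_mod_cast hk0, fun p hp => ?_⟩
  obtain ⟨hs, hle⟩ := h p
  have key : (M (2 ^ k * p) / M (2 ^ k * p + 1)) * (k / 2) ≤ A * (M p / M (p + 1)) := by
    calc (M (2 ^ k * p) / M (2 ^ k * p + 1)) * (k / 2)
        ≤ (M (2 ^ k * p) / M (2 ^ k * p + 1)) *
          ∑ j ∈ Finset.Ico p (2 ^ k * p), (1 : ℝ) / (j + 1) :=
          mul_le_mul_of_nonneg_left (half_mul_le_sum_Ico_inv p hp k) (hν _).le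
      _ ≤ ∑ j ∈ Finset.Ico p (2 ^ k * p), M j / ((j + 1 : ℝ) * M (j + 1)) := by
          rw [Finset.mul_sum]
          refine Finset.sum_le_sum fun j hj => ?_
          have := hanti (Finset.mem_Ico.1 hj).2.le
          calc _ ≤ M j / M (j + 1) * (1 / (j + 1 : ℝ)) :=
                mul_le_mul_of_nonneg_right this (by positivity)
            _ = _ := by rw [div_mul_div_comm, mul_one, mul_comm (M (j + 1))]
      _ = ∑ j ∈ Finset.range (2 ^ k * p - p),
            M (p + j) / (((p + j : ℕ) + 1 : ℝ) * M (p + j + 1)) := by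
          rw [Finset.sum_Ico_eq_sum_range]
      _ ≤ _ := hs.sum_le_tsum _ fun j _ => by
          have := hM.pos (p + j); have := hM.pos (p + j + 1); positivity
      _ ≤ _ := hle
  have h3 := hν (2 ^ k * p)
  have h4 : (M (2 ^ k * p) / M (2 ^ k * p + 1)) * (2 * A) ≤
      (M (2 ^ k * p) / M (2 ^ k * p + 1)) * (k / 2) :=
    mul_le_mul_of_nonneg_left (by linarith) h3.le
  have h5 : A * (2 * (M (2 ^ k * p) / M (2 ^ k * p + 1))) ≤ A * (M p / M (p + 1)) := by linarith
  have := le_of_mul_le_mul_left h5 hA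
  linarith

theorem StronglyRegular.regularWeight {M : ℕ → ℝ} (hM : StronglyRegular M) : RegularWeight M where
  pos := hM.pos
  zero := hM.zero
  lc := hM.lc
  mg := by
    obtain ⟨A, hA, h⟩ := hM.mg
    refine ⟨max A 1, le_max_right _ _, fun p q => (h p q).trans ?_⟩
    have := hM.pos p; have := hM.pos q
    gcongr
    exact le_max_left _ _
  summable_rpow := by
    obtain ⟨k, hk1, hk⟩ := hM.exists_ratio_le_half
    have hanti := antitone_ratio hM.pos hM.lc
    set ν : ℕ → ℝ := fun p => M p / M (p + 1) with hνdef
    have hν : ∀ p, 0 < ν p := fun p => div_pos (hM.pos _) (hM.pos _)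
    have hgeo : ∀ i, ν ((2 ^ k) ^ i) ≤ ν 1 * (1 / 2) ^ i := by
      intro i
      induction i with
      | zero => simp
      | succ i ih =>
        have := hk ((2 ^ k) ^ i) (Nat.one_le_iff_ne_zero.2 (by positivity))
        have h2 : (2 ^ k) * (2 ^ k) ^ i = (2 ^ k) ^ (i + 1) := by ring
        rw [h2] at this
        calc ν ((2 ^ k) ^ (i + 1)) ≤ ν ((2 ^ k) ^ i) / 2 := this
          _ ≤ ν 1 * (1 / 2) ^ i / 2 := by linarith
          _ = _ := by ring
    -- Halving each time the index is multiplied by `2^k` means decay of order `p^(-1/k)`, so the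
    -- power `2k` is dominated by `p⁻²`.
    refine ⟨(2 * k : ℕ), by exact_mod_cast (by omega), ?_⟩
    simp only [Real.rpow_natCast]
    have hN : 1 < 2 ^ k := Nat.one_lt_two_pow (by omega)
    have hsum : Summable fun p : ℕ => ν 1 ^ (2 * k) * ((2 : ℝ) ^ k) ^ 2 * (1 / (p : ℝ) ^ 2) :=
      (Real.summable_one_div_nat_pow.2 (by norm_num)).mul_left _
    rw [← summable_nat_add_iff 1] at hsum ⊢
    refine hsum.of_nonneg_of_le (fun p => by have := hν (p + 1); positivity) fun p => ?_
    set i := Nat.log (2 ^ k) (p + 1)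
    have h1 : (2 ^ k) ^ i ≤ p + 1 := Nat.pow_log_le_self _ (by omega)
    have h2 : p + 1 < (2 ^ k) ^ (i + 1) := Nat.lt_pow_succ_log_self hN _
    have h3 : ν (p + 1) ≤ ν 1 * (1 / 2) ^ i := (hanti h1).trans (hgeo i)
    have h4 : ((p + 1 : ℕ) : ℝ) ≤ ((2 : ℝ) ^ k) ^ (i + 1) := by exact_mod_cast h2.le
    have h5 : (((2 : ℝ) ^ k) ^ i)⁻¹ ≤ (2 : ℝ) ^ k / ((p + 1 : ℕ) : ℝ) := by
      rw [inv_le_comm₀ (by positivity) (by positivity), inv_div, div_le_iff₀ (by positivity)]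
      rwa [pow_succ] at h4
    calc ν (p + 1) ^ (2 * k) ≤ (ν 1 * (1 / 2) ^ i) ^ (2 * k) :=
          pow_le_pow_left₀ (hν _).le h3 _
      _ = ν 1 ^ (2 * k) * ((((2 : ℝ) ^ k) ^ i)⁻¹) ^ 2 := by
          rw [mul_pow, one_div, inv_pow, inv_pow, ← pow_mul, ← pow_mul, inv_pow, ← pow_mul]
          congr 3
          ring
      _ ≤ ν 1 ^ (2 * k) * ((2 : ℝ) ^ k / ((p + 1 : ℕ) : ℝ)) ^ 2 := by
          have := hν 1
          gcongr
      _ = _ := by ring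

/-- Ramified kernels live on the weight `M p ^ (1/q)`. Summability of some power of the ratios is
visibly inherited by it, with exponent `a / s`. -/
theorem RegularWeight.rpow {M : ℕ → ℝ} (hM : RegularWeight M) {s : ℝ} (hs : 0 < s) :
    RegularWeight fun p => M p ^ s where
  pos p := Real.rpow_pos_of_pos (hM.pos p) s
  zero := by simp [hM.zero]
  lc p := by
    rw [← Real.mul_rpow (hM.pos _).le (hM.pos _).le, ← Real.rpow_natCast, ← Real.rpow_mul
      (hM.pos _).le, mul_comm s, Real.rpow_mul (hM.pos _).le, Real.rpow_natCast]
    exact Real.rpow_le_rpow (by positivity) (hM.lc p) hs.le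
  mg := by
    obtain ⟨A, hA, h⟩ := hM.mg
    refine ⟨A ^ s, Real.one_le_rpow hA hs.le, fun p q => ?_⟩
    have hp := hM.pos p; have hq := hM.pos q
    have := Real.rpow_le_rpow (hM.pos _).le (h p q) hs.le
    rwa [Real.mul_rpow (by positivity) hq.le, Real.mul_rpow (by positivity) hp.le,
      ← Real.rpow_natCast, ← Real.rpow_mul (by positivity), mul_comm _ s, Real.rpow_mul
      (by positivity), Real.rpow_natCast] at this
  summable_rpow := by
    obtain ⟨a, ha, h⟩ := hM.summable_rpow
    refine ⟨a / s, by positivity, h.congr fun p => ?_⟩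
    rw [← Real.div_rpow (hM.pos _).le (hM.pos _).le, ← Real.rpow_mul
      (div_pos (hM.pos _) (hM.pos _)).le, mul_div_cancel₀ _ hs.ne']

/-! ### Growth of the associated function and positivity of the index -/

namespace RegularWeight

variable {M : ℕ → ℝ} (hM : RegularWeight M)
include hM

theorem antitone : Antitone fun p => M p / M (p + 1) := antitone_ratio hM.pos hM.lc

/-- The associated function grows at most like a power. -/
theorem exists_log_le : ∃ a C : ℝ, 0 < a ∧ 0 < C ∧ ∀ t : ℝ, 0 < t → ∀ p : ℕ,
    Real.log (t ^ p / M p) ≤ C * t ^ a := by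
  obtain ⟨a, ha, hs⟩ := hM.summable_rpow
  have hν : ∀ p, 0 < M p / M (p + 1) := fun p => div_pos (hM.pos _) (hM.pos _)
  set S := ∑' p, (M p / M (p + 1)) ^ a
  have hS : 0 < S := hs.tsum_pos (fun p => (Real.rpow_pos_of_pos (hν p) a).le) 0
    (Real.rpow_pos_of_pos (hν 0) a)
  refine ⟨a, S / a, ha, by positivity, fun t ht p => ?_⟩
  -- The logarithm is the sum of `log (t * M j / M (j+1))` over `j < p`, and `log x ≤ x^a / a`.
  have hlog : Real.log (t ^ p / M p) ≤
      ∑ j ∈ Finset.range p, (M j / M (j + 1)) ^ a * (t ^ a / a) := by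
    induction p with
    | zero => simp [hM.zero]
    | succ p ih =>
      have h1 : t ^ (p + 1) / M (p + 1) = (t ^ p / M p) * (t * (M p / M (p + 1))) := by
        have := (hM.pos p).ne'; have := (hM.pos (p + 1)).ne'
        field_simp
        ring
      rw [h1, Real.log_mul (by have := hM.pos p; positivity) (by have := hν p; positivity),
        Finset.sum_range_succ]
      have h2 := Real.log_le_rpow_div (mul_nonneg ht.le (hν p).le) ha
      rw [Real.mul_rpow ht.le (hν p).le] at h2
      have h3 : t ^ a * (M p / M (p + 1)) ^ a / a = (M p / M (p + 1)) ^ a * (t ^ a / a) := by ring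
      linarith
  refine hlog.trans ?_
  rw [← Finset.sum_mul]
  calc _ ≤ S * (t ^ a / a) := mul_le_mul_of_nonneg_right
        (hs.sum_le_tsum _ fun j _ => (Real.rpow_pos_of_pos (hν j) a).le) (by positivity)
    _ = _ := by ring

theorem bddAbove {t : ℝ} (ht : 0 ≤ t) : BddAbove (Set.range fun p => Real.log (t ^ p / M p)) := by
  rcases ht.eq_or_lt with rfl | ht
  · refine ⟨0, ?_⟩
    rintro _ ⟨p, rfl⟩
    rcases p with _ | p <;> simp [hM.zero]
  · obtain ⟨a, C, -, -, h⟩ := hM.exists_log_le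
    exact ⟨C * t ^ a, by rintro _ ⟨p, rfl⟩; exact h t ht p⟩

theorem log_le_assocFun {t : ℝ} (ht : 0 ≤ t) (p : ℕ) :
    Real.log (t ^ p / M p) ≤ assocFun M t := le_ciSup (hM.bddAbove ht) p

theorem assocFun_nonneg {t : ℝ} (ht : 0 ≤ t) : 0 ≤ assocFun M t := by
  simpa [hM.zero] using hM.log_le_assocFun ht 0

theorem div_le_exp_assocFun {t : ℝ} (ht : 0 < t) (p : ℕ) :
    t ^ p / M p ≤ Real.exp (assocFun M t) := by
  have := hM.pos p
  exact (Real.log_le_iff_le_exp (by positivity)).1 (hM.log_le_assocFun ht.le p)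

theorem exp_neg_assocFun_le {t : ℝ} (ht : 0 < t) (p : ℕ) :
    Real.exp (-assocFun M t) ≤ M p / t ^ p := by
  have := hM.pos p
  rw [Real.exp_neg, inv_le_comm₀ (Real.exp_pos _) (by positivity), inv_div]
  exact hM.div_le_exp_assocFun ht p

theorem exp_assocFun_le {t C : ℝ} (ht : 0 < t) (h : ∀ p, t ^ p / M p ≤ C) :
    Real.exp (assocFun M t) ≤ C := by
  have hC : 0 < C := lt_of_lt_of_le (by have := hM.pos 0; positivity) (h 0)
  rw [← Real.le_log_iff_exp_le hC]
  refine ciSup_le fun p => Real.log_le_log ?_ (h p)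
  have := hM.pos p; positivity

theorem assocFun_mono {s t : ℝ} (hs : 0 ≤ s) (hst : s ≤ t) : assocFun M s ≤ assocFun M t := by
  rcases hs.eq_or_lt with rfl | hs
  · refine ciSup_le fun p => ?_
    rcases p with _ | p
    · simpa [hM.zero] using hM.assocFun_nonneg hst
    · simpa using hM.assocFun_nonneg hst
  · refine ciSup_le fun p => (Real.log_le_log ?_ ?_).trans (hM.log_le_assocFun (hs.le.trans hst) p)
    · have := hM.pos p; positivity
    · have := hM.pos p; gcongr

/-- Multiplication by the variable is absorbed by a dilation. -/
theorem exists_mul_exp_assocFun_le : ∃ A C : ℝ, 1 ≤ A ∧ 0 < C ∧ ∀ t : ℝ, 0 < t →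
    t * Real.exp (assocFun M t) ≤ C * Real.exp (assocFun M (A * t)) := by
  obtain ⟨A, hA, h⟩ := hM.mg
  refine ⟨A, M 1, hA, hM.pos 1, fun t ht => ?_⟩
  rw [← le_div_iff₀' ht]
  refine hM.exp_assocFun_le ht fun p => ?_
  rw [le_div_iff₀ ht]
  have hp := hM.pos p; have hp1 := hM.pos (p + 1); have h1 := hM.pos 1
  -- Moderate growth with second index `1` turns the extra factor `t` into the next term of the
  -- supremum at `A * t`.
  calc t ^ p / M p * t = M 1 * (t ^ (p + 1) / (M p * M 1)) := by field_simp; ring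
    _ ≤ M 1 * ((A * t) ^ (p + 1) / M (p + 1)) := by
        refine mul_le_mul_of_nonneg_left ?_ h1.le
        rw [div_le_div_iff₀ (by positivity) hp1, mul_pow]
        calc t ^ (p + 1) * M (p + 1) ≤ t ^ (p + 1) * (A ^ (p + 1) * M p * M 1) := by
              gcongr; exact h p 1
          _ = _ := by ring
    _ ≤ _ := by gcongr; exact hM.div_le_exp_assocFun (by positivity) _

/-- The supremum defining the associated function is attained at any prescribed index. -/
theorem exists_exp_assocFun_eq (p : ℕ) :
    ∃ t : ℝ, 0 < t ∧ Real.exp (assocFun M t) ≤ t ^ p / M p := by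
  have hp := hM.pos p
  have ht : 0 < M (p + 1) / M p := div_pos (hM.pos _) hp
  have hratio : ∀ {i j}, i ≤ j → M (i + 1) * M j ≤ M i * M (j + 1) := fun {i j} hij => by
    have := hM.antitone hij
    simp only [] at this
    rw [div_le_div_iff₀ (hM.pos _) (hM.pos _)] at this
    linarith
  -- At `t = M (p+1) / M p` the terms `t^j / M j` increase up to `j = p` and do not increase
  -- afterwards, because `M (j+1) / M j` is monotone.
  refine ⟨_, ht, hM.exp_assocFun_le ht fun j => ?_⟩
  set t := M (p + 1) / M p with htdef
  rcases le_total p j with hj | hj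
  · induction j, hj using Nat.le_induction with
    | base => exact le_rfl
    | succ j hj ih =>
      refine le_trans ?_ ih
      rw [div_le_div_iff₀ (hM.pos _) (hM.pos _), pow_succ, mul_assoc]
      refine mul_le_mul_of_nonneg_left ?_ (by positivity)
      rw [htdef, div_mul_eq_mul_div, div_le_iff₀ hp]
      linarith [hratio hj]
  · induction hj using Nat.decreasingInduction with
    | self => exact le_rfl
    | of_succ j hj ih =>
      refine le_trans ?_ ih
      rw [div_le_div_iff₀ (hM.pos _) (hM.pos _), pow_succ, mul_assoc]
      refine mul_le_mul_of_nonneg_left ?_ (by positivity)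
      rw [htdef, div_mul_eq_mul_div, le_div_iff₀ hp]
      linarith [hratio hj.le]

/-- The associated function grows at least like a power. -/
theorem exists_le_assocFun : ∃ b c : ℝ, 0 < b ∧ 0 < c ∧ ∃ t₀ : ℝ, ∀ t : ℝ, t₀ ≤ t →
    c * t ^ b ≤ assocFun M t := by
  obtain ⟨A₀, hA₀, h₀⟩ := hM.mg
  -- The constant is enlarged so that `log A > 0` below.
  obtain ⟨A, hA, h⟩ : ∃ A : ℝ, 2 ≤ A ∧ ∀ p q, M (p + q) ≤ A ^ (p + q) * M p * M q := by
    refine ⟨max A₀ 2, le_max_right _ _, fun p q => (h₀ p q).trans ?_⟩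
    have := hM.pos p; have := hM.pos q
    gcongr
    exact le_max_left _ _
  -- By moderate growth, the term of index `2p` at `A * t` is at least the square of the term of
  -- index `p` at `t`. Iteration gives growth with exponent `log 2 / log A`.
  have hdouble : ∀ t, 0 < t → 2 * assocFun M t ≤ assocFun M (A * t) := by
    intro t ht
    rw [← le_div_iff₀' two_pos]
    refine ciSup_le fun p => ?_
    rw [le_div_iff₀' two_pos]
    refine le_trans ?_ (hM.log_le_assocFun (by positivity) (p + p))
    have hp := hM.pos p; have hpp := hM.pos (p + p)
    rw [← Nat.cast_ofNat, ← Real.log_pow]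
    refine Real.log_le_log (by positivity) ?_
    rw [div_pow, div_le_div_iff₀ (by positivity) hpp]
    calc (t ^ p) ^ 2 * M (p + p) ≤ (t ^ p) ^ 2 * (A ^ (p + p) * M p * M p) := by
          gcongr; exact h p p
      _ = _ := by ring
  -- Chosen so that the term of index `1` has logarithm exactly `1`.
  set t₀ : ℝ := Real.exp 1 * M 1 with ht₀
  have h1 := hM.pos 1
  have ht₀pos : 0 < t₀ := by positivity
  have hbase : 1 ≤ assocFun M t₀ := by
    have := hM.log_le_assocFun ht₀pos.le 1
    rwa [pow_one, ht₀, mul_div_cancel_right₀ _ h1.ne', Real.log_exp] at this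
  have hpow : ∀ n : ℕ, 2 ^ n ≤ assocFun M (A ^ n * t₀) := by
    intro n
    induction n with
    | zero => simpa using hbase
    | succ n ih =>
      have := hdouble (A ^ n * t₀) (by positivity)
      rw [pow_succ', pow_succ', mul_assoc]
      linarith
  have hA1 : 1 < A := by linarith
  have hlogA : 0 < Real.log A := Real.log_pos hA1
  set b := Real.log 2 / Real.log A with hb
  have hb0 : 0 < b := div_pos (Real.log_pos one_lt_two) hlogA
  have hAb : A ^ b = 2 := by
    rw [Real.rpow_def_of_pos (by linarith), hb, mul_div_cancel₀ _ hlogA.ne',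
      Real.exp_log two_pos]
  refine ⟨b, 1 / 2 * (t₀ ^ b)⁻¹, hb0, by positivity, t₀, fun t ht => ?_⟩
  obtain ⟨n, hn1, hn2⟩ := exists_nat_pow_near ((one_le_div ht₀pos).2 ht) hA1
  rw [le_div_iff₀ ht₀pos] at hn1
  have h2 : (t / t₀) ^ b ≤ 2 * 2 ^ n := by
    calc (t / t₀) ^ b ≤ (A ^ (n + 1)) ^ b := by
          have : 0 < t := ht₀pos.trans_le ht
          gcongr
      _ = 2 * 2 ^ n := by
          rw [← Real.rpow_natCast, ← Real.rpow_mul (by linarith), mul_comm, Real.rpow_mul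
            (by linarith), hAb, Real.rpow_natCast, pow_succ']
  calc 1 / 2 * (t₀ ^ b)⁻¹ * t ^ b = 1 / 2 * (t / t₀) ^ b := by
        rw [Real.div_rpow (ht₀pos.le.trans ht) ht₀pos.le]; ring
    _ ≤ 2 ^ n := by linarith
    _ ≤ _ := (hpow n).trans (hM.assocFun_mono (by positivity) hn1)

/-- The upper and lower power bounds put the order in `[b/2, a+1]`, so its inverse is neither `0`
nor `∞` and `toReal` takes no default value. Positivity makes the sector of `e` nonempty. -/
theorem omega_pos : 0 < omega M := by
  obtain ⟨a, C, ha, hC, hup⟩ := hM.exists_log_le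
  obtain ⟨b, c, hb, hc, t₀, hlow⟩ := hM.exists_le_assocFun
  have hlog : Tendsto Real.log atTop atTop := Real.tendsto_log_atTop
  have hpos : ∀ᶠ r : ℝ in atTop, 0 < Real.log r ∧ 0 < r ∧ t₀ ≤ r ∧ 0 < assocFun M r := by
    filter_upwards [hlog.eventually_gt_atTop 0, eventually_gt_atTop 0, eventually_ge_atTop t₀]
      with r h1 h2 h3
    exact ⟨h1, h2, h3, lt_of_lt_of_le (by positivity) (hlow r h3)⟩
  have hle : order M ≤ ENNReal.ofReal (a + 1) := by
    refine limsup_le_of_le (by isBoundedDefault) ?_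
    filter_upwards [hpos, hlog.eventually_ge_atTop (Real.log C)] with r ⟨h1, h2, _, h4⟩ h5
    refine ENNReal.ofReal_le_ofReal ?_
    rw [div_le_iff₀ h1]
    have h6 : assocFun M r ≤ C * r ^ a := ciSup_le (hup r h2)
    have := Real.log_le_log h4 h6
    rw [Real.log_mul hC.ne' (by positivity), Real.log_rpow h2] at this
    linarith
  have hge : ENNReal.ofReal (b / 2) ≤ order M := by
    refine le_limsup_of_frequently_le (Eventually.frequently ?_) (by isBoundedDefault)
    filter_upwards [hpos, hlog.eventually_ge_atTop (-Real.log c * (2 / b))] with r ⟨h1, h2, h3, h4⟩ h5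
    refine ENNReal.ofReal_le_ofReal ?_
    rw [le_div_iff₀ h1]
    have := Real.log_le_log (by positivity) (hlow r h3)
    rw [Real.log_mul hc.ne' (by positivity), Real.log_rpow h2] at this
    have h6 : -Real.log c ≤ b / 2 * Real.log r := by
      have := mul_le_mul_of_nonneg_left h5 (half_pos hb).le
      calc -Real.log c = b / 2 * (-Real.log c * (2 / b)) := by field_simp
        _ ≤ _ := this
    linarith
  refine ENNReal.toReal_pos ?_ ?_
  · exact ENNReal.inv_ne_zero.2 (ne_top_of_le_ne_top ENNReal.ofReal_ne_top hle)
  · refine ENNReal.inv_ne_top.2 (ne_of_gt (lt_of_lt_of_le ?_ hge))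
    exact ENNReal.ofReal_pos.2 (by positivity)

end RegularWeight

/-! ### Holomorphic dependence of integrals on a parameter -/

/-- A local bound on the integrand alone suffices: Cauchy's estimate on circles of radius `ε/4`
turns it into an integrable bound for the derivative in the parameter. -/
theorem differentiableOn_integral_of_dominated {α F : Type*} [MeasurableSpace α] {μ : Measure α}
    [NormedAddCommGroup F] [NormedSpace ℂ F] [CompleteSpace F] {U : Set ℂ} (hU : IsOpen U)
    {H : ℂ → α → F} (hmeas : ∀ z ∈ U, AEStronglyMeasurable (H z) μ)
    (hdiff : ∀ᵐ t ∂μ, DifferentiableOn ℂ (fun z => H z t) U)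
    (hbound : ∀ z₀ ∈ U, ∃ ε > 0, ∃ bound : α → ℝ, Integrable bound μ ∧
      ∀ᵐ t ∂μ, ∀ z ∈ U, dist z z₀ < ε → ‖H z t‖ ≤ bound t) :
    DifferentiableOn ℂ (fun z => ∫ t, H z t ∂μ) U := by
  intro z₀ hz₀
  obtain ⟨ε₁, hε₁, bound, hint, hb⟩ := hbound z₀ hz₀
  obtain ⟨ε₂, hε₂, hball⟩ := Metric.isOpen_iff.1 hU z₀ hz₀
  set ε := min ε₁ ε₂ with hε
  have hε0 : 0 < ε := lt_min hε₁ hε₂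
  have hsub : Metric.ball z₀ ε ⊆ U := (Metric.ball_subset_ball (min_le_right _ _)).trans hball
  have hdist : ∀ z ∈ Metric.ball z₀ (ε / 2), Metric.closedBall z (ε / 4) ⊆ Metric.ball z₀ ε := by
    intro z hz w hw
    rw [Metric.mem_ball, Metric.mem_closedBall] at *
    linarith [dist_triangle w z z₀]
  have hderiv : ∀ᵐ t ∂μ, ∀ z ∈ Metric.ball z₀ (ε / 2),
      HasDerivAt (fun z => H z t) (deriv (fun z => H z t) z) z := by
    filter_upwards [hdiff] with t ht z hz
    exact ((ht z (hsub (Metric.ball_subset_ball (by linarith) hz))).differentiableAt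
      (hU.mem_nhds (hsub (Metric.ball_subset_ball (by linarith) hz)))).hasDerivAt
  have hz₀b : z₀ ∈ Metric.ball z₀ (ε / 2) := Metric.mem_ball_self (by linarith)
  -- The derivative is a pointwise limit of difference quotients along a sequence of increments,
  -- each of which is measurable in `t`.
  have hmeas' : AEStronglyMeasurable (fun t => deriv (fun z => H z t) z₀) μ := by
    have hlim : Tendsto (fun n : ℕ => z₀ + ((ε / 2) / (n + 2) : ℝ)) atTop (𝓝[≠] z₀) := by
      refine tendsto_nhdsWithin_iff.2 ⟨?_, Eventually.of_forall fun n => ?_⟩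
      · have h1 : Tendsto (fun n : ℕ => (ε / 2) / ((n : ℝ) + 2)) atTop (𝓝 0) :=
          tendsto_const_nhds.div_atTop
            (tendsto_atTop_add_const_right _ _ tendsto_natCast_atTop_atTop)
        have h2 := (Complex.continuous_ofReal.tendsto 0).comp h1
        simpa using h2.const_add z₀
      · have : ((ε / 2) / (n + 2) : ℝ) ≠ 0 := by positivity
        simpa only [Set.mem_compl_iff, Set.mem_singleton_iff, add_eq_left, Complex.ofReal_eq_zero]
          using this
    refine aestronglyMeasurable_of_tendsto_ae atTop
      (f := fun (n : ℕ) t => slope (fun z => H z t) z₀ (z₀ + ((ε / 2) / (n + 2) : ℝ))) ?_ ?_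
    · intro n
      have hmem : z₀ + (((ε / 2) / (n + 2) : ℝ) : ℂ) ∈ U := by
        refine hsub ?_
        rw [Metric.mem_ball, dist_eq_norm, add_sub_cancel_left, Complex.norm_real,
          Real.norm_of_nonneg (by positivity), div_lt_iff₀ (by positivity)]
        nlinarith
      simp only [slope, vsub_eq_sub]
      exact ((hmeas _ hmem).sub (hmeas _ hz₀)).const_smul _
    · filter_upwards [hderiv] with t ht
      exact (hasDerivAt_iff_tendsto_slope.1 (ht z₀ hz₀b)).comp hlim
  have hint0 : Integrable (H z₀) μ := by
    refine hint.mono' (hmeas z₀ hz₀) ?_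
    filter_upwards [hb] with t ht
    exact ht z₀ hz₀ (by simpa using hε₁)
  refine (hasDerivAt_integral_of_dominated_loc_of_deriv_le
    (bound := fun t => bound t / (ε / 4)) (Metric.ball_mem_nhds z₀ (half_pos hε0)) ?_ hint0 hmeas'
    ?_ (hint.div_const _) hderiv).2.differentiableAt.differentiableWithinAt
  · filter_upwards [hU.mem_nhds hz₀] with z hz using hmeas z hz
  · filter_upwards [hdiff, hb] with t ht htb z hz
    refine Complex.norm_deriv_le_of_forall_mem_sphere_norm_le (by linarith) ?_ ?_
    · refine (ht.mono ?_).diffContOnCl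
      exact closure_minimal Metric.ball_subset_closedBall Metric.isClosed_closedBall |>.trans
        ((hdist z hz).trans hsub)
    · intro w hw
      have := hdist z hz (Metric.sphere_subset_closedBall hw)
      exact htb w (hsub this) (lt_of_lt_of_le this (min_le_left _ _))

/-! ### Taylor coefficients -/

theorem coeff_eq_circleIntegral {F : Type*} [NormedAddCommGroup F] [NormedSpace ℂ F]
    [CompleteSpace F] {g : ℂ → F} {b : ℕ → F} {r ρ : ℝ} (hρ : 0 < ρ) (hρr : ρ < r)
    (hg : DifferentiableOn ℂ g (Metric.ball 0 r))
    (hb : ∀ᶠ z : ℂ in 𝓝 0, HasSum (fun p : ℕ => z ^ p • b p) (g z)) (p : ℕ) :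
    b p = (2 * Real.pi * Complex.I : ℂ)⁻¹ • ∮ w in C(0, ρ), (w⁻¹) ^ p • w⁻¹ • g w := by
  lift ρ to NNReal using hρ.le
  have h1 : HasFPowerSeriesAt g (cauchyPowerSeries g 0 ρ) 0 :=
    ((hg.mono (Metric.closedBall_subset_ball hρr)).hasFPowerSeriesOnBall
      (by exact_mod_cast hρ)).hasFPowerSeriesAt
  set P : FormalMultilinearSeries ℂ ℂ F :=
    fun n => ContinuousMultilinearMap.mkPiRing ℂ (Fin n) (b n) with hP
  have h2 : HasFPowerSeriesAt g P 0 := by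
    rw [hasFPowerSeriesAt_iff]
    filter_upwards [hb] with z hz
    simpa [FormalMultilinearSeries.coeff, hP] using hz
  have h3 : (P p fun _ => (1 : ℂ)) = cauchyPowerSeries g 0 ρ p fun _ => (1 : ℂ) := by
    rw [h2.eq_formalMultilinearSeries h1]
  rw [cauchyPowerSeries_apply] at h3
  simpa only [hP, ContinuousMultilinearMap.mkPiRing_apply, Finset.prod_const_one, one_smul,
    sub_zero, one_div] using h3

theorem norm_coeff_le {F : Type*} [NormedAddCommGroup F] [NormedSpace ℂ F]
    [CompleteSpace F] {g : ℂ → F} {b : ℕ → F} {r ρ C : ℝ} (hρ : 0 < ρ) (hρr : ρ < r)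
    (hg : DifferentiableOn ℂ g (Metric.ball 0 r))
    (hb : ∀ᶠ z : ℂ in 𝓝 0, HasSum (fun p : ℕ => z ^ p • b p) (g z))
    (hC : ∀ z : ℂ, ‖z‖ = ρ → ‖g z‖ ≤ C) (p : ℕ) : ‖b p‖ ≤ C / ρ ^ p := by
  rw [coeff_eq_circleIntegral hρ hρr hg hb p]
  refine (circleIntegral.norm_two_pi_i_inv_smul_integral_le_of_norm_le_const hρ.le
    (C := (ρ⁻¹) ^ p * (ρ⁻¹ * C)) fun z hz => ?_).trans_eq ?_
  · rw [mem_sphere_zero_iff_norm] at hz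
    rw [norm_smul, norm_smul, norm_pow, norm_inv, hz]
    gcongr
    exact hC z hz
  · field_simp
    rw [one_div, inv_pow, mul_right_comm, inv_mul_cancel₀ (by positivity), one_mul]

/-! ### Sectors in logarithmic coordinates -/

theorem exp_mem_sector {d θ : ℝ} {v : ℂ} (hθ : θ ≤ 2 * Real.pi) (hv : |v.im - d| < θ / 2) :
    Complex.exp v ∈ sector d θ := by
  refine ⟨Complex.exp_ne_zero v, ?_⟩
  have h := abs_lt.1 hv
  rw [← Complex.exp_add, Complex.arg_exp, (toIocMod_eq_self Real.two_pi_pos).2]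
  · simpa [← sub_eq_add_neg] using hv
  · simp only [Complex.add_im, Complex.neg_im, Complex.mul_I_im, Complex.ofReal_re]
    constructor <;> linarith [h.1, h.2]

theorem exists_exp_of_mem_sector {d θ : ℝ} {z : ℂ} (hz : z ∈ sector d θ) :
    ∃ v : ℂ, Complex.exp v = z ∧ |v.im - d| < θ / 2 := by
  have hne : z * Complex.exp (-(d * Complex.I)) ≠ 0 := mul_ne_zero hz.1 (Complex.exp_ne_zero _)
  refine ⟨Complex.log (z * Complex.exp (-(d * Complex.I))) + d * Complex.I, ?_, ?_⟩
  · rw [Complex.exp_add, Complex.exp_log hne, mul_assoc, ← Complex.exp_add]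
    simp
  · simpa [Complex.log_im] using hz.2

theorem isOpen_sector (d θ : ℝ) (hθ : θ ≤ 2 * Real.pi) : IsOpen (sector d θ) := by
  have : sector d θ = {z : ℂ | z * Complex.exp (-(d * Complex.I)) ∈ Complex.slitPlane ∧
      |(z * Complex.exp (-(d * Complex.I))).arg| < θ / 2} := by
    ext z
    refine and_congr_left fun h => ?_
    rw [Complex.mem_slitPlane_iff_arg]
    refine ⟨fun hz => ⟨fun h' => ?_, mul_ne_zero hz (Complex.exp_ne_zero _)⟩,
      fun hz => left_ne_zero_of_mul hz.2⟩
    rw [h', abs_of_pos Real.pi_pos] at h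
    linarith
  rw [this]
  have hc : Continuous fun z : ℂ => z * Complex.exp (-(d * Complex.I)) := by fun_prop
  rw [isOpen_iff_mem_nhds]
  rintro z ⟨h1, h2⟩
  filter_upwards [hc.continuousAt.eventually (Complex.isOpen_slitPlane.mem_nhds h1),
    hc.continuousAt.eventually
      ((Complex.continuousAt_arg h1).abs.eventually_lt_const h2)] with w hw1 hw2
  exact ⟨hw1, hw2⟩

theorem isOpen_hatSector (d θ r : ℝ) (hθ : θ ≤ 2 * Real.pi) : IsOpen (hatSector d θ r) :=
  (isOpen_sector d θ hθ).union Metric.isOpen_ball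

/-! ### Integrals of the weight -/

namespace RegularWeight

variable {M : ℕ → ℝ} (hM : RegularWeight M)
include hM

/-- Testing the supremum at the indices `n` and `n + 2` gains the integrable factor `1 / (1 + s^2)`.
-/
theorem pow_mul_exp_neg_le {k : ℝ} (hk : 0 < k) (n : ℕ) {t : ℝ} (ht : 0 < t) :
    t ^ n * Real.exp (-assocFun M (t / k)) ≤
      k ^ n * (M n + M (n + 2)) * (1 + (t / k) ^ 2)⁻¹ := by
  have hs : 0 < t / k := by positivity
  rw [← div_eq_mul_inv, le_div_iff₀ (by positivity)]
  set s := t / k with hsdef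
  have hts : t = k * s := by rw [hsdef]; field_simp
  have h1 := hM.exp_neg_assocFun_le hs n
  have h2 := hM.exp_neg_assocFun_le hs (n + 2)
  rw [le_div_iff₀ (by positivity)] at h1 h2
  rw [hts, mul_pow]
  calc k ^ n * s ^ n * Real.exp (-assocFun M s) * (1 + s ^ 2)
      = k ^ n * (Real.exp (-assocFun M s) * s ^ n + Real.exp (-assocFun M s) * s ^ (n + 2)) := by
        ring
    _ ≤ _ := by gcongr

theorem integrableOn_pow_mul_exp_neg {k : ℝ} (hk : 0 < k) (n : ℕ) :
    IntegrableOn (fun t : ℝ => t ^ n * Real.exp (-assocFun M (t / k))) (Set.Ioi 0) := by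
  have hint : Integrable (fun t : ℝ => k ^ n * (M n + M (n + 2)) * (1 + (t / k) ^ 2)⁻¹) :=
    (integrable_inv_one_add_sq.comp_div hk.ne').const_mul _
  refine hint.integrableOn.mono' ?_ ?_
  · have hanti : AntitoneOn (fun t : ℝ => Real.exp (-assocFun M (t / k))) (Set.Ioi 0) :=
      fun s hs t _ hst => Real.exp_le_exp.2 (neg_le_neg (hM.assocFun_mono
        (div_nonneg (le_of_lt hs) hk.le) (by gcongr)))
    have := aemeasurable_restrict_of_antitoneOn (μ := volume) measurableSet_Ioi hanti
    exact ((measurable_id.pow_const n).aemeasurable.mul this).aestronglyMeasurable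
  · filter_upwards [ae_restrict_mem measurableSet_Ioi] with t ht
    have ht' : 0 < t := ht
    rw [Real.norm_of_nonneg (by positivity)]
    exact hM.pow_mul_exp_neg_le hk n ht

theorem integral_pow_mul_exp_neg_le {k : ℝ} (hk : 0 < k) (n : ℕ) :
    ∫ t in Set.Ioi (0 : ℝ), t ^ n * Real.exp (-assocFun M (t / k)) ≤
      k ^ (n + 1) * (Real.pi * (M n + M (n + 2))) := by
  have hint : Integrable (fun t : ℝ => k ^ n * (M n + M (n + 2)) * (1 + (t / k) ^ 2)⁻¹) :=
    (integrable_inv_one_add_sq.comp_div hk.ne').const_mul _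
  have hn := hM.pos n; have hn2 := hM.pos (n + 2)
  calc _ ≤ ∫ t in Set.Ioi (0 : ℝ), k ^ n * (M n + M (n + 2)) * (1 + (t / k) ^ 2)⁻¹ :=
        setIntegral_mono_on (hM.integrableOn_pow_mul_exp_neg hk n) hint.integrableOn
          measurableSet_Ioi fun t ht => hM.pow_mul_exp_neg_le hk n ht
    _ ≤ ∫ t : ℝ, k ^ n * (M n + M (n + 2)) * (1 + (t / k) ^ 2)⁻¹ :=
        setIntegral_le_integral hint (Eventually.of_forall fun t => by positivity)
    _ = _ := by
        rw [integral_const_mul, Measure.integral_comp_div (fun x : ℝ => (1 + x ^ 2)⁻¹) k,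
          integral_univ_inv_one_add_sq, abs_of_pos hk, smul_eq_mul]
        ring

end RegularWeight

/-! ### Kernels for multiplication of Taylor coefficients -/

/-- The series `∑ h_j x^j` converges near the origin and extends to the plane slit along the
positive real axis, with bounds on closed subsectors. -/
def ExtendsToSlitPlane (h : ℕ → ℂ) : Prop :=
  ∃ (K : ℂ → ℂ) (r : ℝ), 0 < r ∧ DifferentiableOn ℂ K (Metric.ball 0 r) ∧
    DifferentiableOn ℂ K {x | -x ∈ Complex.slitPlane} ∧
    (∀ x ∈ Metric.ball (0 : ℂ) r, HasSum (fun j => h j * x ^ j) (K x)) ∧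
    ∀ δ : ℝ, 0 < δ → ∃ C : ℝ, ∀ v : ℂ, |v.im| ≤ Real.pi - δ → ‖K (-Complex.exp v)‖ ≤ C

theorem momentFun_succ (e : ℂ → ℂ) (n : ℕ) :
    momentFun e ((n + 1 : ℕ) : ℂ) = ∫ t in Set.Ioi (0 : ℝ), (t : ℂ) ^ n * e t := by
  unfold momentFun mellin
  refine setIntegral_congr_fun measurableSet_Ioi fun t _ => ?_
  simp

theorem differentiableOn_tsum_of_geometric {h : ℕ → ℂ} {r C : ℝ}
    (hh : ∀ j, ‖h j‖ * r ^ j ≤ C * (1 / 2) ^ j) :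
    DifferentiableOn ℂ (fun x => ∑' j, h j * x ^ j) (Metric.ball 0 r) := by
  refine Complex.differentiableOn_tsum_of_summable_norm (summable_geometric_two.mul_left C)
    (fun j => by fun_prop) Metric.isOpen_ball fun j x hx => ?_
  rw [mem_ball_zero_iff] at hx
  rw [norm_mul, norm_pow]
  exact le_trans (by gcongr) (hh j)

theorem summable_of_geometric {h : ℕ → ℂ} {r C : ℝ}
    (hh : ∀ j, ‖h j‖ * r ^ j ≤ C * (1 / 2) ^ j) {x : ℂ} (hx : ‖x‖ ≤ r) :
    Summable fun j => h j * x ^ j := by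
  refine (summable_geometric_two.mul_left C).of_norm_bounded fun j => ?_
  rw [norm_mul, norm_pow]
  exact le_trans (by gcongr) (hh j)

/-! ### Bounds for the kernel functions in logarithmic coordinates -/

namespace IsKernelPair

variable {M : ℕ → ℝ} {e E : ℂ → ℂ} (hk : IsKernelPair M e E)

include hk in
theorem exists_norm_e_exp_le {δ : ℝ} (hδ : 0 < δ) : ∃ c k : ℝ, 0 < c ∧ 0 < k ∧
    ∀ v : ℂ, |v.im| ≤ omega M / 2 * Real.pi - δ →
      ‖e (Complex.exp v)‖ ≤ c * Real.exp (-assocFun M (Real.exp v.re / k)) := by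
  obtain ⟨c, k, hc, hk0, h⟩ := hk.e_decay δ hδ
  refine ⟨c, k, hc, hk0, fun v hv => ?_⟩
  have := h (Complex.exp v) (exp_mem_sector ?_ ?_)
  · rwa [Complex.norm_exp] at this
  · nlinarith [hk.omega_lt_two, Real.pi_pos]
  · rw [sub_zero]; linarith

include hk in
-- Outside the unit disc the decay of `E` is used only as boundedness; inside, continuity on a
-- compact set is enough.
theorem exists_norm_E_neg_exp_le {δ : ℝ} (hδ : 0 < δ) : ∃ C : ℝ, 0 < C ∧
    ∀ v : ℂ, |v.im| ≤ (1 - omega M / 2) * Real.pi - δ → ‖E (-Complex.exp v)‖ ≤ C := by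
  obtain ⟨β, hβ, h⟩ := hk.E_decay
  have hω := hk.omega_lt_two
  have hω0 : 0 ≤ omega M := ENNReal.toReal_nonneg
  have hπ := Real.pi_pos
  set γ := (1 - omega M / 2) * Real.pi with hγ
  have hγ0 : 0 < γ := mul_pos (by linarith) hπ
  have hγπ : γ ≤ Real.pi := by nlinarith
  -- Keeps the opening `2γ - δ'` positive when `δ` is large.
  set δ' := min δ γ
  have hδ' : 0 < δ' := lt_min hδ hγ0
  have hδγ : δ' ≤ γ := min_le_right _ _
  obtain ⟨c, hc, hdec⟩ := h (2 * γ - δ') (by linarith) (by linarith) 1 one_pos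
  obtain ⟨B, hB⟩ := (isCompact_closedBall (0 : ℂ) 1).exists_bound_of_continuousOn
    hk.E_entire.continuous.continuousOn
  refine ⟨max c B, lt_max_of_lt_left hc, fun v hv => ?_⟩
  rcases le_or_gt ‖Complex.exp v‖ 1 with h1 | h1
  · exact (hB _ (by simpa using h1)).trans (le_max_right _ _)
  · have hmem : -Complex.exp v ∈ sector Real.pi (2 * γ - δ') := by
      have := exp_mem_sector (d := Real.pi) (θ := 2 * γ - δ') (v := v + Real.pi * Complex.I)
        (by linarith) (by simp only [Complex.add_im, Complex.mul_I_im, Complex.ofReal_re,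
          add_sub_cancel_right]; linarith [min_le_left δ γ])
      rwa [Complex.exp_add, Complex.exp_pi_mul_I, mul_neg_one] at this
    have h2 := hdec _ ⟨hmem, by simpa using h1.le⟩
    rw [norm_neg] at h2
    have h3 : (1 : ℝ) ≤ ‖Complex.exp v‖ ^ β := Real.one_le_rpow h1.le hβ.le
    exact (h2.trans (div_le_self hc.le h3)).trans (le_max_left _ _)

include hk in
-- The numbers `1 / m_e(p)` are the Taylor coefficients of `E`. Cauchy's estimate is applied at the
-- radius `k * t`, where `t` makes the index `p` optimal in the associated function.
theorem exists_norm_inv_moment_le (hM : RegularWeight M) : ∃ c k : ℝ, 0 < c ∧ 0 < k ∧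
    ∀ p : ℕ, ‖(momentFun e p)⁻¹‖ ≤ c / (k ^ p * M p) := by
  obtain ⟨c, k, hc, hk0, h⟩ := hk.E_growth
  refine ⟨c, k, hc, hk0, fun p => ?_⟩
  obtain ⟨t, ht, hexp⟩ := hM.exists_exp_assocFun_eq p
  have hMp := hM.pos p
  have := norm_coeff_le (g := E) (b := fun p : ℕ => (momentFun e p)⁻¹) (r := k * t + 1)
    (ρ := k * t) (C := c * (t ^ p / M p)) (by positivity) (by linarith)
    hk.E_entire.differentiableOn (Eventually.of_forall fun z => by
      simpa [div_eq_mul_inv] using hk.E_series z) (fun z hz => (h z).trans ?_) p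
  · refine this.trans_eq ?_
    rw [mul_pow]
    field_simp
  · rw [hz, mul_div_cancel_left₀ _ hk0.ne']
    gcongr

include hk in
theorem continuousOn_e_ray {v : ℂ} (hv : |v.im| < omega M / 2 * Real.pi) :
    ContinuousOn (fun t : ℝ => e (t * Complex.exp v)) (Set.Ioi 0) := by
  refine hk.e_holo.continuousOn.comp (by fun_prop) fun t ht => ?_
  have ht' : (0 : ℝ) < t := ht
  rw [show (t : ℂ) = Complex.exp (Real.log t) by
    rw [← Complex.ofReal_exp, Real.exp_log ht'], ← Complex.exp_add]
  refine exp_mem_sector ?_ ?_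
  · nlinarith [hk.omega_lt_two, Real.pi_pos]
  · simpa using hv.trans_eq (by ring)

include hk in
/-- Bounds for the moments of `|e|` against the inverses of the moments of `e`. -/
theorem exists_integral_norm_le (hM : RegularWeight M) (n : ℕ) : ∃ C D : ℝ, 0 < C ∧ 0 < D ∧
    ∀ j : ℕ, IntegrableOn (fun t : ℝ => (t : ℂ) ^ (n + j) * e t) (Set.Ioi 0) ∧
      ‖(momentFun e j)⁻¹‖ * ∫ t in Set.Ioi (0 : ℝ), ‖(t : ℂ) ^ (n + j) * e t‖ ≤ C * D ^ j := by
  have hκ : 0 < omega M / 2 * Real.pi := mul_pos (half_pos hM.omega_pos) Real.pi_pos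
  obtain ⟨c, k, hc, hk0, he⟩ := hk.exists_norm_e_exp_le hκ
  obtain ⟨c', k', hc', hk'0, hinv⟩ := hk.exists_norm_inv_moment_le hM
  obtain ⟨A, hA, hmg⟩ := hM.mg
  have hbound : ∀ j : ℕ, ∀ t ∈ Set.Ioi (0 : ℝ), ‖(t : ℂ) ^ (n + j) * e t‖ ≤
      c * (t ^ (n + j) * Real.exp (-assocFun M (t / k))) := by
    intro j t ht
    have ht' : (0 : ℝ) < t := ht
    have := he (Real.log t) (by simp)
    rw [← Complex.ofReal_exp, Complex.ofReal_re, Real.exp_log ht'] at this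
    rw [norm_mul, norm_pow, Complex.norm_real, Real.norm_of_nonneg ht'.le, mul_left_comm]
    gcongr
  have hint : ∀ j : ℕ, IntegrableOn (fun t : ℝ => (t : ℂ) ^ (n + j) * e t) (Set.Ioi 0) := by
    intro j
    refine ((hM.integrableOn_pow_mul_exp_neg hk0 (n + j)).const_mul c).mono' ?_ ?_
    · refine ContinuousOn.aestronglyMeasurable ?_ measurableSet_Ioi
      have := hk.continuousOn_e_ray (v := 0) (by simpa using hκ)
      simp only [Complex.exp_zero, mul_one] at this
      exact ContinuousOn.mul (by fun_prop) this
    · filter_upwards [ae_restrict_mem measurableSet_Ioi] with t ht using hbound j t ht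
  have hn := hM.pos n; have hn2 := hM.pos (n + 2)
  -- Growth of `E` gives `1 / (k'^j M_j)`, decay of `e` gives `k^j` times `M_{n+j}` and `M_{n+j+2}`,
  -- and moderate growth reduces the latter to `A^j M_j`. Hence the geometric rate `k A / k'`.
  refine ⟨c' * (c * (k ^ (n + 1) * (Real.pi * (A ^ n * M n + A ^ (n + 2) * M (n + 2))))),
    k * A / k', by positivity, by positivity, fun j => ⟨hint j, ?_⟩⟩
  have hj := hM.pos j
  have hI : ∫ t in Set.Ioi (0 : ℝ), ‖(t : ℂ) ^ (n + j) * e t‖ ≤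
      c * (k ^ (n + j + 1) * (Real.pi * (M (n + j) + M (n + j + 2)))) := by
    calc _ ≤ ∫ t in Set.Ioi (0 : ℝ), c * (t ^ (n + j) * Real.exp (-assocFun M (t / k))) :=
          setIntegral_mono_on (hint j).norm
            ((hM.integrableOn_pow_mul_exp_neg hk0 (n + j)).const_mul c) measurableSet_Ioi (hbound j)
      _ ≤ _ := by
          rw [integral_const_mul]
          gcongr
          exact hM.integral_pow_mul_exp_neg_le hk0 _
  have h1 : M (n + j) ≤ A ^ (n + j) * M n * M j := hmg n j
  have h2 : M (n + j + 2) ≤ A ^ (n + 2 + j) * M (n + 2) * M j := by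
    have := hmg (n + 2) j
    rwa [show n + 2 + j = n + j + 2 by ring] at this ⊢
  calc _ ≤ c' / (k' ^ j * M j) * (c * (k ^ (n + j + 1) * (Real.pi *
        (A ^ (n + j) * M n * M j + A ^ (n + 2 + j) * M (n + 2) * M j)))) := by
        gcongr
        · exact hinv j
        · refine hI.trans ?_
          gcongr
    _ = _ := by
        rw [div_pow, mul_pow, pow_add A, pow_add A (n + 2), pow_add k, pow_add k n 1, pow_add k n j]
        field_simp

end IsKernelPair

/-! ### Continuation of the series of moment quotients to the strip -/

/-- The integrand of the kernel function in the logarithmic variable. -/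
noncomputable def stripIntegrand (M : ℕ → ℝ) (e E : ℂ → ℂ) (n : ℕ) (v : ℂ) (t : ℝ) : ℂ :=
  (t : ℂ) ^ n * Complex.exp (-((n + 1) * (omega M / 2) * v)) *
    E (-(t * Complex.exp ((1 - omega M / 2) * v))) * e (t * Complex.exp (-(omega M / 2 * v)))

namespace IsKernelPair

variable {M : ℕ → ℝ} {e E : ℂ → ℂ} (hk : IsKernelPair M e E)

include hk in
-- The imaginary part of `v` is shared between the two factors in the ratio `1 - κ` to `κ`, with `κ
-- = omega M / 2`. As long as `|Im v| ≤ π - δ`, both arguments keep a positive angular distance from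
-- the boundary of their sectors.
theorem exists_norm_stripIntegrand_le (hM : RegularWeight M) (n : ℕ) {δ : ℝ} (hδ : 0 < δ) :
    ∃ C k : ℝ, 0 < C ∧ 0 < k ∧ ∀ v : ℂ, |v.im| ≤ Real.pi - δ → ∀ t : ℝ, 0 < t →
      ‖stripIntegrand M e E n v t‖ ≤ C * (Real.exp (-(omega M / 2 * v.re)) ^ (n + 1) *
        (t ^ n * Real.exp (-assocFun M (t / (k / Real.exp (-(omega M / 2 * v.re))))))) := by
  have hω0 := hM.omega_pos
  have hω := hk.omega_lt_two
  set κ := omega M / 2 with hκ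
  have hκ0 : 0 < κ := half_pos hω0
  have hκ1 : 0 < 1 - κ := by rw [hκ]; linarith
  obtain ⟨c, k, hc, hk0, he⟩ := hk.exists_norm_e_exp_le (mul_pos hκ0 hδ)
  obtain ⟨B, hB, hE⟩ := hk.exists_norm_E_neg_exp_le (mul_pos hκ1 hδ)
  rw [← hκ] at he hE
  refine ⟨B * c, k, by positivity, hk0, fun v hv t ht => ?_⟩
  have htexp : (t : ℂ) = Complex.exp (Real.log t) := by
    rw [← Complex.ofReal_exp, Real.exp_log ht]
  have h1 := he (Real.log t + -(κ * v)) (by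
    simp only [Complex.add_im, Complex.ofReal_im, Complex.neg_im,
      Complex.im_ofReal_mul, zero_add, abs_neg, abs_mul, abs_of_pos hκ0]
    exact (mul_le_mul_of_nonneg_left hv hκ0.le).trans_eq (mul_sub _ _ _))
  have h2 := hE (Real.log t + (1 - κ : ℝ) * v) (by
    simp only [Complex.add_im, Complex.ofReal_im, Complex.im_ofReal_mul, zero_add, abs_mul,
      abs_of_pos hκ1]
    exact (mul_le_mul_of_nonneg_left hv hκ1.le).trans_eq (mul_sub _ _ _))
  rw [Complex.exp_add, ← htexp] at h1 h2
  have h3 : Real.exp ((Real.log t + -(κ * v) : ℂ)).re / k =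
      t / (k / Real.exp (-(κ * v.re))) := by
    simp only [Complex.add_re, Complex.ofReal_re, Complex.neg_re, Complex.re_ofReal_mul]
    rw [Real.exp_add, Real.exp_log ht]
    field_simp
  rw [h3] at h1
  have h4 : ‖Complex.exp (-((n + 1) * κ * v))‖ = Real.exp (-(κ * v.re)) ^ (n + 1) := by
    rw [show (-((n + 1) * κ * v) : ℂ) = (n + 1 : ℕ) * (-(κ * v)) by push_cast; ring,
      Complex.exp_nat_mul, norm_pow, Complex.norm_exp]
    simp
  have h5 : (omega M : ℂ) / 2 = κ := by rw [hκ]; simp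
  push_cast at h2
  rw [stripIntegrand, h5, norm_mul, norm_mul, norm_mul, h4, norm_pow, Complex.norm_real,
    Real.norm_of_nonneg ht.le]
  calc _ ≤ t ^ n * Real.exp (-(κ * v.re)) ^ (n + 1) * B * (c * Real.exp
        (-assocFun M (t / (k / Real.exp (-(κ * v.re)))))) := by gcongr
    _ = _ := by ring

include hk in
theorem aestronglyMeasurable_stripIntegrand (hM : RegularWeight M) (n : ℕ) {v : ℂ}
    (hv : |v.im| < Real.pi) :
    AEStronglyMeasurable (stripIntegrand M e E n v) (volume.restrict (Set.Ioi 0)) := by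
  refine ContinuousOn.aestronglyMeasurable ?_ measurableSet_Ioi
  have hω0 := half_pos hM.omega_pos
  have h1 := hk.continuousOn_e_ray (v := -(omega M / 2 * v)) (by
    rw [show (omega M : ℂ) / 2 = (omega M / 2 : ℝ) by simp, Complex.neg_im, Complex.im_ofReal_mul,
      abs_neg, abs_mul, abs_of_pos hω0]
    gcongr)
  have h2 := hk.E_entire.continuous
  refine ContinuousOn.mul (Continuous.continuousOn ?_) h1
  fun_prop

include hk in
theorem differentiableOn_stripIntegrand (hM : RegularWeight M) (n : ℕ) {t : ℝ} (ht : 0 < t) :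
    DifferentiableOn ℂ (fun v => stripIntegrand M e E n v t) {v | |v.im| < Real.pi} := by
  have hω0 := half_pos hM.omega_pos
  have h1 : DifferentiableOn ℂ (fun v => e (t * Complex.exp (-(omega M / 2 * v))))
      {v | |v.im| < Real.pi} := by
    refine hk.e_holo.comp (by fun_prop) fun v hv => ?_
    rw [show (t : ℂ) = Complex.exp (Real.log t) by
      rw [← Complex.ofReal_exp, Real.exp_log ht], ← Complex.exp_add]
    refine exp_mem_sector ?_ ?_
    · nlinarith [hk.omega_lt_two, Real.pi_pos]
    · rw [show (omega M : ℂ) / 2 = (omega M / 2 : ℝ) by simp, Complex.add_im, Complex.neg_im,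
        Complex.im_ofReal_mul, Complex.ofReal_im, zero_add, sub_zero, abs_neg, abs_mul,
        abs_of_pos hω0]
      have : |v.im| < Real.pi := hv
      nlinarith
  have h2 := hk.E_entire
  refine DifferentiableOn.mul (Differentiable.differentiableOn ?_) h1
  fun_prop

/-- The kernel function in the logarithmic variable. -/
noncomputable def _root_.MomentSummability.stripKernel (M : ℕ → ℝ) (e E : ℂ → ℂ) (n : ℕ) (v : ℂ) :
    ℂ := ∫ t in Set.Ioi (0 : ℝ), stripIntegrand M e E n v t

theorem _root_.MomentSummability.isOpen_strip : IsOpen {v : ℂ | |v.im| < Real.pi} :=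
  isOpen_lt (by fun_prop) continuous_const

include hk in
theorem differentiableOn_stripKernel (hM : RegularWeight M) (n : ℕ) :
    DifferentiableOn ℂ (stripKernel M e E n) {v | |v.im| < Real.pi} := by
  have hκ0 := half_pos hM.omega_pos
  refine differentiableOn_integral_of_dominated isOpen_strip
    (fun v hv => hk.aestronglyMeasurable_stripIntegrand hM n hv) ?_ ?_
  · filter_upwards [ae_restrict_mem measurableSet_Ioi] with t ht
    exact hk.differentiableOn_stripIntegrand hM n ht
  · intro v₀ hv₀
    have hv₀' : |v₀.im| < Real.pi := hv₀
    set δ := (Real.pi - |v₀.im|) / 2 with hδ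
    have hδ0 : 0 < δ := by linarith
    obtain ⟨C, k, hC, hk0, h⟩ := hk.exists_norm_stripIntegrand_le hM n hδ0
    -- A common bound for `exp (κ Re v)` and `exp (-κ Re v)` near `v₀`.
    set a := Real.exp (omega M / 2 * (|v₀.re| + 1)) with ha
    have ha0 : 0 < a := Real.exp_pos _
    refine ⟨min δ 1, lt_min hδ0 one_pos, fun t => C * (a ^ (n + 1) *
      (t ^ n * Real.exp (-assocFun M (t / (k * a))))),
      ((hM.integrableOn_pow_mul_exp_neg (by positivity) n).const_mul _).const_mul _, ?_⟩
    filter_upwards [ae_restrict_mem measurableSet_Ioi] with t ht v hv hd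
    have ht' : (0 : ℝ) < t := ht
    have hnorm : ‖v - v₀‖ < min δ 1 := by rwa [dist_eq_norm] at hd
    have him : |v.im - v₀.im| < δ := by
      have := Complex.abs_im_le_norm (v - v₀)
      rw [Complex.sub_im] at this
      exact (this.trans_lt hnorm).trans_le (min_le_left _ _)
    have hre : |v.re - v₀.re| < 1 := by
      have := Complex.abs_re_le_norm (v - v₀)
      rw [Complex.sub_re] at this
      exact (this.trans_lt hnorm).trans_le (min_le_right _ _)
    have him' : |v.im| ≤ Real.pi - δ := by
      have := abs_sub_abs_le_abs_sub v.im v₀.im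
      linarith
    have hre' : |v.re| ≤ |v₀.re| + 1 := by
      have := abs_sub_abs_le_abs_sub v.re v₀.re
      linarith
    have hre'' := abs_le.1 hre'
    refine (h v him' t ht').trans ?_
    have h1 : Real.exp (-(omega M / 2 * v.re)) ≤ a := by
      refine Real.exp_le_exp.2 ?_
      nlinarith
    have h2 : k / Real.exp (-(omega M / 2 * v.re)) ≤ k * a := by
      rw [div_eq_mul_inv, ← Real.exp_neg]
      refine mul_le_mul_of_nonneg_left (Real.exp_le_exp.2 ?_) hk0.le
      nlinarith
    gcongr
    exact hM.assocFun_mono (by positivity) (by gcongr)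

include hk in
-- The factor `a^(n+1)` produced by the dilation cancels after integration, so the bound is uniform
-- in `Re v` as well.
theorem exists_norm_stripKernel_le (hM : RegularWeight M) (n : ℕ) {δ : ℝ} (hδ : 0 < δ) :
    ∃ C : ℝ, ∀ v : ℂ, |v.im| ≤ Real.pi - δ → ‖stripKernel M e E n v‖ ≤ C := by
  obtain ⟨C, k, hC, hk0, h⟩ := hk.exists_norm_stripIntegrand_le hM n hδ
  refine ⟨C * (k ^ (n + 1) * (Real.pi * (M n + M (n + 2)))), fun v hv => ?_⟩
  set a := Real.exp (-(omega M / 2 * v.re)) with ha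
  have ha0 : 0 < a := Real.exp_pos _
  have hka : 0 < k / a := by positivity
  calc ‖stripKernel M e E n v‖ ≤ ∫ t in Set.Ioi (0 : ℝ), C * (a ^ (n + 1) *
        (t ^ n * Real.exp (-assocFun M (t / (k / a))))) := by
        refine norm_integral_le_of_norm_le
          (((hM.integrableOn_pow_mul_exp_neg hka n).const_mul _).const_mul _) ?_
        filter_upwards [ae_restrict_mem measurableSet_Ioi] with t ht using h v hv t ht
    _ ≤ C * (a ^ (n + 1) * ((k / a) ^ (n + 1) * (Real.pi * (M n + M (n + 2))))) := by
        rw [integral_const_mul, integral_const_mul]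
        gcongr
        exact hM.integral_pow_mul_exp_neg_le hka n
    _ = _ := by rw [div_pow]; field_simp

/-- For real `v` the change of variable is a genuine dilation of the half-line; no contour has to be
rotated. -/
theorem _root_.MomentSummability.stripKernel_ofReal (M : ℕ → ℝ) (e E : ℂ → ℂ) (n : ℕ) (x : ℝ) :
    stripKernel M e E n x =
    ∫ t in Set.Ioi (0 : ℝ), (t : ℂ) ^ n * E (-(t * Complex.exp x)) * e t := by
  set a := Real.exp (-(omega M / 2 * x)) with ha
  have ha0 : 0 < a := Real.exp_pos _
  have h := integral_comp_mul_left_Ioi'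
    (fun t : ℝ => (t : ℂ) ^ n * E (-(t * Complex.exp x)) * e t) 0 ha0
  rw [mul_zero] at h
  rw [← h, stripKernel, ← integral_smul]
  refine setIntegral_congr_fun measurableSet_Ioi fun t _ => ?_
  have h1 : Complex.exp (-(omega M / 2 * x)) = a := by rw [ha]; push_cast; rfl
  have h2 : Complex.exp (-((n + 1) * (omega M / 2) * x)) = (a : ℂ) ^ (n + 1) := by
    rw [← h1, ← Complex.exp_nat_mul]
    congr 1
    push_cast
    ring
  have h3 : Complex.exp ((1 - omega M / 2) * x) = a * Complex.exp x := by
    rw [← h1, ← Complex.exp_add]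
    congr 1
    ring
  simp only [stripIntegrand, h1, h2, h3, Complex.real_smul, Complex.ofReal_mul]
  rw [show (t : ℂ) * (a * Complex.exp x) = a * t * Complex.exp x by ring, mul_comm (t : ℂ) a]
  ring

include hk in
-- For real `v`, the series of `E` is integrated termwise against `t^n e(t)`. Both sides are
-- holomorphic on a half-strip, so the identity theorem extends the equality from the real
-- half-line.
theorem exists_hasSum_stripKernel (hM : RegularWeight M) (n : ℕ) : ∃ r C : ℝ, 0 < r ∧
    (∀ j : ℕ, ‖momentFun e ((n + 1 + j : ℕ) : ℂ) / momentFun e j‖ * r ^ j ≤ C * (1 / 2) ^ j) ∧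
    ∀ v : ℂ, |v.im| < Real.pi → Real.exp v.re < r →
      HasSum (fun j : ℕ => momentFun e ((n + 1 + j : ℕ) : ℂ) / momentFun e j *
        (-Complex.exp v) ^ j) (stripKernel M e E n v) := by
  obtain ⟨C, D, hC, hD, h⟩ := hk.exists_integral_norm_le hM n
  -- Half the inverse geometric rate, so that all series are dominated by `C * (1/2)^j`.
  set r := (2 * D)⁻¹ with hr
  have hr0 : 0 < r := by positivity
  have hDr : D * r = 1 / 2 := by rw [hr]; field_simp
  have hmom : ∀ j : ℕ, momentFun e ((n + 1 + j : ℕ) : ℂ) =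
      ∫ t in Set.Ioi (0 : ℝ), (t : ℂ) ^ (n + j) * e t := fun j => by
    rw [show n + 1 + j = n + j + 1 by ring, momentFun_succ]
  have hgeo : ∀ j : ℕ, ‖momentFun e ((n + 1 + j : ℕ) : ℂ) / momentFun e j‖ * r ^ j ≤
      C * (1 / 2) ^ j := by
    intro j
    rw [← hDr, mul_pow, ← mul_assoc]
    refine mul_le_mul_of_nonneg_right ?_ (by positivity)
    rw [div_eq_mul_inv, norm_mul, mul_comm, hmom]
    refine le_trans ?_ (h j).2
    gcongr
    exact norm_integral_le_integral_norm _
  refine ⟨r, C, hr0, hgeo, ?_⟩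
  set c : ℕ → ℂ := fun j => momentFun e ((n + 1 + j : ℕ) : ℂ) / momentFun e j with hc
  have hreal : ∀ x : ℝ, Real.exp x < r →
      HasSum (fun j : ℕ => c j * (-Complex.exp x) ^ j) (stripKernel M e E n x) := by
    intro x hx
    rw [stripKernel_ofReal]
    have hF : ∀ j : ℕ, (fun t : ℝ => (-Complex.exp x) ^ j * (momentFun e j)⁻¹ *
        ((t : ℂ) ^ (n + j) * e t)) = fun t : ℝ =>
        (t : ℂ) ^ n * ((-(t * Complex.exp x)) ^ j / momentFun e j) * e t := by
      intro j; ext t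
      rw [← mul_neg, mul_pow, pow_add]
      ring
    have hsum := hasSum_integral_of_summable_integral_norm (μ := volume.restrict (Set.Ioi (0 : ℝ)))
      (F := fun (j : ℕ) (t : ℝ) => (-Complex.exp x) ^ j * (momentFun e j)⁻¹ *
        ((t : ℂ) ^ (n + j) * e t)) (fun j => (h j).1.const_mul _) (by
        refine (summable_geometric_two.mul_left C).of_nonneg_of_le
          (fun j => by positivity) fun j => ?_
        simp only [norm_mul _ ((_ : ℂ) * e _)]
        rw [integral_const_mul, norm_mul, mul_assoc, norm_pow, norm_neg, Complex.norm_exp,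
          Complex.ofReal_re, ← hDr, mul_pow, ← mul_assoc C, mul_comm]
        exact mul_le_mul (h j).2 (by gcongr) (by positivity) (by positivity))
    have hterm : (fun j : ℕ => c j * (-Complex.exp x) ^ j) = fun j : ℕ =>
        ∫ t in Set.Ioi (0 : ℝ), (-Complex.exp x) ^ j * (momentFun e j)⁻¹ *
          ((t : ℂ) ^ (n + j) * e t) := by
      ext j
      rw [integral_const_mul, ← hmom, hc]
      ring
    have hval : ∫ t in Set.Ioi (0 : ℝ), (t : ℂ) ^ n * E (-(t * Complex.exp x)) * e t =
        ∫ t in Set.Ioi (0 : ℝ), ∑' j : ℕ, (-Complex.exp x) ^ j * (momentFun e j)⁻¹ *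
          ((t : ℂ) ^ (n + j) * e t) := by
      refine setIntegral_congr_fun measurableSet_Ioi fun t _ => ?_
      have h1 := ((hk.E_series (-(t * Complex.exp x))).mul_left ((t : ℂ) ^ n)).mul_right (e t)
      refine (h1.tsum_eq.symm.trans ?_)
      exact tsum_congr fun j => (congrFun (hF j) t).symm
    rw [hterm, hval]
    exact hsum
  intro v hv hvr
  set S : Set ℂ := {v | |v.im| < Real.pi} ∩ {v | v.re < Real.log r} with hS
  have hSopen : IsOpen S := isOpen_strip.inter (isOpen_lt Complex.continuous_re continuous_const)
  have hSconv : Convex ℝ S := by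
    have h1 : {v : ℂ | |v.im| < Real.pi} = {v | -Real.pi < v.im} ∩ {v | v.im < Real.pi} := by
      ext v; exact abs_lt (a := v.im)
    rw [hS, h1]
    exact ((convex_halfSpace_im_gt _).inter (convex_halfSpace_im_lt _)).inter
      (convex_halfSpace_re_lt _)
  have hball : ∀ v ∈ S, -Complex.exp v ∈ Metric.ball (0 : ℂ) r := fun v hv => by
    rw [mem_ball_zero_iff, norm_neg, Complex.norm_exp, ← Real.lt_log_iff_exp_lt hr0]
    exact hv.2
  have hf : AnalyticOnNhd ℂ (stripKernel M e E n) S :=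
    ((hk.differentiableOn_stripKernel hM n).mono Set.inter_subset_left).analyticOnNhd hSopen
  have hg : AnalyticOnNhd ℂ (fun v => ∑' j, c j * (-Complex.exp v) ^ j) S :=
    ((differentiableOn_tsum_of_geometric hgeo).comp (by fun_prop) hball).analyticOnNhd hSopen
  have hx₀ : ((Real.log r - 1 : ℝ) : ℂ) ∈ S :=
    ⟨by simpa using Real.pi_pos, by simp⟩
  have hfreq : ∃ᶠ z in 𝓝[≠] ((Real.log r - 1 : ℝ) : ℂ),
      stripKernel M e E n z = ∑' j, c j * (-Complex.exp z) ^ j := by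
    have htend : Tendsto (fun x : ℝ => (x : ℂ)) (𝓝[≠] (Real.log r - 1))
        (𝓝[≠] ((Real.log r - 1 : ℝ) : ℂ)) := by
      refine tendsto_nhdsWithin_iff.2
        ⟨(Complex.continuous_ofReal.tendsto _).mono_left nhdsWithin_le_nhds, ?_⟩
      filter_upwards [self_mem_nhdsWithin] with x hx
      exact fun h => hx (Complex.ofReal_injective h)
    refine htend.frequently (Eventually.frequently ?_)
    filter_upwards [mem_nhdsWithin_of_mem_nhds (Iio_mem_nhds (sub_one_lt (Real.log r)))] with x hx
    exact (hreal x ((Real.lt_log_iff_exp_lt hr0).1 hx)).tsum_eq.symm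
  have heq := hf.eqOn_of_preconnected_of_frequently_eq hg hSconv.isPreconnected hx₀ hfreq
  have hvS : v ∈ S := ⟨hv, (Real.lt_log_iff_exp_lt hr0).2 hvr⟩
  rw [heq hvS]
  exact (summable_of_geometric hgeo (by simpa [Complex.norm_exp] using hvr.le)).hasSum

end IsKernelPair

/-! ### Ramification -/

/-- The logarithms of the `q`-th roots, normalized to lie in the strip `|Im| < π`. -/
noncomputable def rootShift (q l : ℕ) (w : ℂ) : ℂ :=
  (w + (Real.pi * (2 * l + 1 - q) : ℝ) * Complex.I) / q

theorem rootShift_re (q l : ℕ) (w : ℂ) : (rootShift q l w).re = w.re / q := by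
  simp [rootShift, Complex.div_natCast_re]

/-- The shift before division by `q` is at most `π (q - 1)` in absolute value, which leaves a margin
`δ` out of `π q`. -/
theorem abs_rootShift_im_le {q l : ℕ} (hl : l < q) {w : ℂ} {δ : ℝ} (hw : |w.im| ≤ Real.pi - δ) :
    |(rootShift q l w).im| ≤ Real.pi - δ / q := by
  have hq : (0 : ℝ) < q := by exact_mod_cast Nat.zero_lt_of_lt hl
  have hl' : (l : ℝ) + 1 ≤ q := by exact_mod_cast hl
  have hl0 : (0 : ℝ) ≤ l := Nat.cast_nonneg l
  have hπ := Real.pi_pos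
  have h := abs_le.1 hw
  rw [show (rootShift q l w).im = (w.im + Real.pi * (2 * l + 1 - q)) / q by
    simp only [rootShift, Complex.div_natCast_im, Complex.add_im, Complex.mul_I_im,
      Complex.ofReal_re], abs_div, abs_of_pos hq, div_le_iff₀ hq, sub_mul, div_mul_cancel₀ _ hq.ne']
  rw [abs_le]
  constructor <;> nlinarith

theorem neg_exp_rootShift_pow {q : ℕ} (hq : q ≠ 0) (l : ℕ) (w : ℂ) (j : ℕ) :
    (-Complex.exp (rootShift q l w)) ^ j =
      Complex.exp (j * (w + Real.pi * Complex.I) / q) *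
        Complex.exp (2 * Real.pi * Complex.I * (j / q)) ^ l := by
  have hq' : (q : ℂ) ≠ 0 := by exact_mod_cast hq
  rw [show -Complex.exp (rootShift q l w) =
    Complex.exp (rootShift q l w + Real.pi * Complex.I) by
      rw [Complex.exp_add, Complex.exp_pi_mul_I, mul_neg_one],
    ← Complex.exp_nat_mul, ← Complex.exp_nat_mul, ← Complex.exp_add]
  congr 1
  rw [rootShift]
  push_cast
  field_simp
  ring

theorem sum_neg_exp_rootShift_pow_mul {q : ℕ} (hq : q ≠ 0) (w : ℂ) (p : ℕ) :
    ∑ l ∈ Finset.range q, (-Complex.exp (rootShift q l w)) ^ (q * p) =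
      q * (-Complex.exp w) ^ p := by
  have hq' : (q : ℂ) ≠ 0 := by exact_mod_cast hq
  have h1 : ∀ l ∈ Finset.range q, (-Complex.exp (rootShift q l w)) ^ (q * p) =
      (-Complex.exp w) ^ p := by
    intro l _
    rw [neg_exp_rootShift_pow hq]
    have h2 : Complex.exp (2 * Real.pi * Complex.I * ((q * p : ℕ) / q)) = 1 := by
      rw [Complex.exp_eq_one_iff]
      refine ⟨p, ?_⟩
      push_cast
      field_simp
    rw [h2, one_pow, mul_one, show -Complex.exp w = Complex.exp (w + Real.pi * Complex.I) by
      rw [Complex.exp_add, Complex.exp_pi_mul_I, mul_neg_one], ← Complex.exp_nat_mul]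
    congr 1
    push_cast
    field_simp
  rw [Finset.sum_congr rfl h1]
  simp

/-- A full geometric sum over the powers of a nontrivial `q`-th root of unity. -/
theorem sum_neg_exp_rootShift_pow_of_not_dvd {q : ℕ} (hq : q ≠ 0) (w : ℂ) {j : ℕ}
    (hj : ¬ q ∣ j) : ∑ l ∈ Finset.range q, (-Complex.exp (rootShift q l w)) ^ j = 0 := by
  have hq' : (q : ℂ) ≠ 0 := by exact_mod_cast hq
  simp only [neg_exp_rootShift_pow hq]
  rw [← Finset.mul_sum, geom_sum_eq, ← Complex.exp_nat_mul]
  · have : Complex.exp (q * (2 * Real.pi * Complex.I * (j / q))) = 1 := by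
      rw [Complex.exp_eq_one_iff]
      refine ⟨j, ?_⟩
      push_cast
      field_simp
    rw [this]
    simp
  · intro h
    obtain ⟨n, hn⟩ := Complex.exp_eq_one_iff.1 h
    have h2 : (j : ℂ) / q = n := by
      have h3 : (2 * Real.pi * Complex.I : ℂ) ≠ 0 := Complex.two_pi_I_ne_zero
      rw [mul_comm (n : ℂ)] at hn
      exact mul_left_cancel₀ h3 hn
    rw [div_eq_iff hq'] at h2
    have h3 : (j : ℤ) = n * q := by exact_mod_cast h2
    exact hj (Int.natCast_dvd_natCast.1 ⟨n, by rw [h3, mul_comm]⟩)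

/-- The subseries with exponents divisible by `q`, in the logarithmic variable. -/
theorem hasSum_average_rootShift {c : ℕ → ℂ} {W : ℂ → ℂ} {r : ℝ} (hr : 0 < r) {q : ℕ} (hq : q ≠ 0)
    (hW : ∀ v : ℂ, |v.im| < Real.pi → Real.exp v.re < r →
      HasSum (fun j : ℕ => c j * (-Complex.exp v) ^ j) (W v))
    {w : ℂ} (hw : |w.im| < Real.pi) (hwr : Real.exp w.re < r ^ q) :
    HasSum (fun p : ℕ => c (q * p) * (-Complex.exp w) ^ p)
      ((q : ℂ)⁻¹ * ∑ l ∈ Finset.range q, W (rootShift q l w)) := by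
  have hq' : (q : ℂ) ≠ 0 := by exact_mod_cast hq
  have hq0 : (0 : ℝ) < q := by exact_mod_cast Nat.pos_of_ne_zero hq
  have h1 : ∀ l ∈ Finset.range q, HasSum (fun j : ℕ => c j * (-Complex.exp (rootShift q l w)) ^ j)
      (W (rootShift q l w)) := by
    intro l hl
    refine hW _ ?_ ?_
    · have := abs_rootShift_im_le (Finset.mem_range.1 hl) (w := w) (δ := Real.pi - |w.im|)
        (by linarith)
      have h3 : 0 < (Real.pi - |w.im|) / q := div_pos (by linarith) hq0
      linarith
    · refine lt_of_pow_lt_pow_left₀ q hr.le ?_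
      rwa [rootShift_re, ← Real.exp_nat_mul, mul_div_cancel₀ _ hq0.ne']
  have h2 := (hasSum_sum h1).mul_left (q : ℂ)⁻¹
  have hinj : Function.Injective fun p : ℕ => q * p := mul_right_injective₀ hq
  rw [← hinj.hasSum_iff] at h2
  · have h3 : (fun p : ℕ => c (q * p) * (-Complex.exp w) ^ p) = (fun j : ℕ => (q : ℂ)⁻¹ *
        ∑ l ∈ Finset.range q, c j * (-Complex.exp (rootShift q l w)) ^ j) ∘ fun p => q * p := by
      ext p
      rw [Function.comp_apply, ← Finset.mul_sum, sum_neg_exp_rootShift_pow_mul hq]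
      field_simp
    rwa [h3]
  · intro j hj
    have : ¬ q ∣ j := fun ⟨p, hp⟩ => hj ⟨p, hp.symm⟩
    rw [← Finset.mul_sum, sum_neg_exp_rootShift_pow_of_not_dvd hq w this, mul_zero, mul_zero]

theorem IsMomentSequenceFor.extendsToSlitPlane {M : ℕ → ℝ} (hM : RegularWeight M) {m : ℕ → ℂ}
    (hm : IsMomentSequenceFor M m) : ExtendsToSlitPlane fun p => m (p + 1) / m p := by
  classical
  obtain ⟨q, e, E, hq1, hk, hmq⟩ := hm
  obtain ⟨n, rfl⟩ : ∃ n, q = n + 1 := ⟨q - 1, by omega⟩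
  set q := n + 1 with hq
  have hq0 : (0 : ℝ) < q := by positivity
  have hN : RegularWeight fun p => M p ^ (1 / q : ℝ) := hM.rpow (by positivity)
  obtain ⟨r, C, hr, hgeo, hsum⟩ := hk.exists_hasSum_stripKernel hN n
  set W := stripKernel (fun p => M p ^ (1 / q : ℝ)) e E n
  set c : ℕ → ℂ := fun j => momentFun e ((n + 1 + j : ℕ) : ℂ) / momentFun e j with hc
  -- Since `m p = m_e(q p)`, the quotient is `m_e(q p + q) / m_e(q p)`. The exponent of `t` is
  -- therefore `n = q - 1`.
  have hh : (fun p => m (p + 1) / m p) = fun p => c (q * p) := by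
    ext p
    simp only [hc, hmq]
    congr 2 <;> push_cast [hq] <;> ring
  rw [hh]
  have hgeo' : ∀ p : ℕ, ‖c (q * p)‖ * (r ^ q) ^ p ≤ |C| * (1 / 2) ^ p := by
    intro p
    rw [← pow_mul]
    refine (hgeo (q * p)).trans ?_
    have h1 : (1 / 2 : ℝ) ^ (q * p) ≤ (1 / 2) ^ p :=
      pow_le_pow_of_le_one (by norm_num) (by norm_num) (Nat.le_mul_of_pos_left p hq1)
    exact mul_le_mul (le_abs_self C) h1 (by positivity) (abs_nonneg C)
  set G : ℂ → ℂ := fun w => (q : ℂ)⁻¹ * ∑ l ∈ Finset.range q, W (rootShift q l w) with hG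
  have hGsum : ∀ w : ℂ, |w.im| < Real.pi → Real.exp w.re < r ^ q →
      HasSum (fun p : ℕ => c (q * p) * (-Complex.exp w) ^ p) (G w) := fun w hw hwr =>
    hasSum_average_rootShift hr (by omega) hsum hw hwr
  set P : ℂ → ℂ := fun x => ∑' p, c (q * p) * x ^ p with hP
  -- The power series is used on the disc, which contains part of the slit, and the average over
  -- roots elsewhere. By `hGsum` they agree where both make sense.
  set K : ℂ → ℂ := fun x => if x ∈ Metric.ball (0 : ℂ) (r ^ q) then P x else
    G (Complex.log (-x)) with hK
  have hKG : ∀ w : ℂ, |w.im| < Real.pi → K (-Complex.exp w) = G w := by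
    intro w hw
    have hlog : Complex.log (Complex.exp w) = w := by
      rw [abs_lt] at hw
      exact Complex.log_exp hw.1 hw.2.le
    by_cases hx : -Complex.exp w ∈ Metric.ball (0 : ℂ) (r ^ q)
    · simp only [hK, if_pos hx, hP]
      rw [mem_ball_zero_iff, norm_neg, Complex.norm_exp] at hx
      exact (hGsum w hw hx).tsum_eq
    · simp only [hK, if_neg hx, neg_neg, hlog]
  have hKP : ∀ x ∈ Metric.ball (0 : ℂ) (r ^ q), K x = P x := fun x hx => if_pos hx
  have hslit : ∀ {x : ℂ}, -x ∈ Complex.slitPlane → |(Complex.log (-x)).im| < Real.pi := by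
    intro x hx
    rw [Complex.log_im, abs_lt]
    exact ⟨Complex.neg_pi_lt_arg _, lt_of_le_of_ne (Complex.arg_le_pi _)
      (Complex.mem_slitPlane_iff_arg.1 hx).1⟩
  refine ⟨K, r ^ q, by positivity, ?_, ?_, ?_, ?_⟩
  · exact (differentiableOn_tsum_of_geometric hgeo').congr hKP
  · have hWdiff := hk.differentiableOn_stripKernel hN n
    have hGdiff : DifferentiableOn ℂ G {v | |v.im| < Real.pi} := by
      refine DifferentiableOn.const_mul (DifferentiableOn.fun_sum fun l hl => ?_) _
      refine hWdiff.comp (by unfold rootShift; fun_prop) fun w hw => ?_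
      have hw' : |w.im| < Real.pi := hw
      have := abs_rootShift_im_le (Finset.mem_range.1 hl) (w := w) (δ := Real.pi - |w.im|)
        (by linarith)
      have h3 : 0 < (Real.pi - |w.im|) / q := div_pos (by linarith) hq0
      exact this.trans_lt (by linarith)
    have hcomp : DifferentiableOn ℂ (fun x : ℂ => G (Complex.log (-x)))
        {x | -x ∈ Complex.slitPlane} :=
      hGdiff.comp (DifferentiableOn.clog (by fun_prop) fun x hx => hx) fun x hx => hslit hx
    refine hcomp.congr fun x hx => ?_
    have hne : -x ≠ 0 := Complex.slitPlane_ne_zero hx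
    have := hKG _ (hslit hx)
    rwa [Complex.exp_log hne, neg_neg] at this
  · intro x hx
    rw [hKP x hx]
    exact (summable_of_geometric hgeo' (mem_ball_zero_iff.1 hx).le).hasSum
  · intro δ hδ
    obtain ⟨B, hB⟩ := hk.exists_norm_stripKernel_le hN n (δ := δ / q) (by positivity)
    refine ⟨‖(q : ℂ)⁻¹‖ * ∑ _l ∈ Finset.range q, B, fun v hv => ?_⟩
    rw [hKG v (by linarith), hG, norm_mul]
    gcongr
    exact norm_sum_le_of_le _ fun l hl =>
      hB _ (abs_rootShift_im_le (Finset.mem_range.1 hl) hv)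

/-! ### Keyhole contours in the logarithmic plane -/

section Contour

variable {F : Type*} [NormedAddCommGroup F] [NormedSpace ℂ F]

/-- The points of the contour consisting, in the logarithmic plane, of the two horizontal segments
at heights `d ± α` between the abscissas `l` and `L`, closed by vertical segments. -/
def contourSet (d α l L : ℝ) : Set ℂ :=
  {ζ | (ζ.re ∈ Set.Icc l L ∧ (ζ.im = d - α ∨ ζ.im = d + α)) ∨
    (ζ.re = L ∧ ζ.im ∈ Set.Icc (d - α) (d + α)) ∨
    (ζ.re = l ∧ ζ.im ∈ Set.Icc (d + α) (d - α + 2 * Real.pi))}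

/-- The normalized integral along `contourSet`, run through counterclockwise. -/
noncomputable def contourIntegral (d α l L : ℝ) (Ψ : ℂ → F) : F :=
  (2 * Real.pi * Complex.I : ℂ)⁻¹ •
    ((∫ x in l..L, Ψ (x + (d - α : ℝ) * Complex.I)) - (∫ x in l..L, Ψ (x + (d + α : ℝ) * Complex.I))
      + Complex.I • (∫ y in (d - α)..(d + α), Ψ (L + y * Complex.I))
      + Complex.I • (∫ y in (d + α)..(d - α + 2 * Real.pi), Ψ (l + y * Complex.I)))

variable {d α l L : ℝ}

theorem bottom_mem_contourSet {x : ℝ} (hx : x ∈ Set.Icc l L) :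
    (x + (d - α : ℝ) * Complex.I : ℂ) ∈ contourSet d α l L := Or.inl ⟨by simpa using hx, by simp⟩

theorem top_mem_contourSet {x : ℝ} (hx : x ∈ Set.Icc l L) :
    (x + (d + α : ℝ) * Complex.I : ℂ) ∈ contourSet d α l L := Or.inl ⟨by simpa using hx, by simp⟩

theorem right_mem_contourSet {y : ℝ} (hy : y ∈ Set.Icc (d - α) (d + α)) :
    (L + y * Complex.I : ℂ) ∈ contourSet d α l L := Or.inr (Or.inl ⟨by simp, by simpa using hy⟩)

theorem left_mem_contourSet {y : ℝ} (hy : y ∈ Set.Icc (d + α) (d - α + 2 * Real.pi)) :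
    (l + y * Complex.I : ℂ) ∈ contourSet d α l L := Or.inr (Or.inr ⟨by simp, by simpa using hy⟩)

/-- The two vertical sides have total length `2π` whatever `α` is, and the prefactor `1 / (2π)` is
simply bounded by `1`. -/
theorem norm_contourIntegral_le {Ψ : ℂ → F} {B : ℝ} (hα : 0 ≤ α) (hαπ : α ≤ Real.pi) (hl : l ≤ L)
    (hB : ∀ ζ ∈ contourSet d α l L, ‖Ψ ζ‖ ≤ B) :
    ‖contourIntegral d α l L Ψ‖ ≤ (2 * (L - l) + 2 * Real.pi) * B := by
  have hsub : ∀ {a b : ℝ}, a ≤ b → ∀ x ∈ Set.uIoc a b, x ∈ Set.Icc a b := fun {a b} hab x hx => by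
    rw [Set.uIoc_of_le hab] at hx
    exact Set.Ioc_subset_Icc_self hx
  have h1 := intervalIntegral.norm_integral_le_of_norm_le_const (a := l) (b := L)
    (f := fun x : ℝ => Ψ (x + (d - α : ℝ) * Complex.I))
    fun x hx => hB _ (bottom_mem_contourSet (hsub hl x hx))
  have h2 := intervalIntegral.norm_integral_le_of_norm_le_const (a := l) (b := L)
    (f := fun x : ℝ => Ψ (x + (d + α : ℝ) * Complex.I))
    fun x hx => hB _ (top_mem_contourSet (hsub hl x hx))
  have h3 := intervalIntegral.norm_integral_le_of_norm_le_const (a := d - α) (b := d + α)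
    (f := fun y : ℝ => Ψ (L + y * Complex.I))
    fun x hx => hB _ (right_mem_contourSet (hsub (by linarith) x hx))
  have h4 := intervalIntegral.norm_integral_le_of_norm_le_const (a := d + α)
    (b := d - α + 2 * Real.pi) (f := fun y : ℝ => Ψ (l + y * Complex.I))
    fun x hx => hB _ (left_mem_contourSet (hsub (by linarith) x hx))
  rw [abs_of_nonneg (by linarith)] at h1 h2 h3 h4
  have hpi : ‖(2 * Real.pi * Complex.I : ℂ)⁻¹‖ ≤ 1 := by
    rw [norm_inv]
    refine inv_le_one_of_one_le₀ ?_
    simp only [norm_mul, Complex.norm_real, Complex.norm_I, Real.norm_of_nonneg Real.pi_pos.le,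
      Complex.norm_ofNat]
    linarith [Real.pi_gt_three]
  rw [contourIntegral, norm_smul]
  refine (mul_le_of_le_one_left (norm_nonneg _) hpi).trans ?_
  refine (norm_add_le _ _).trans ?_
  refine (add_le_add_left (norm_add_le _ _) _).trans ?_
  rw [norm_smul, norm_smul, Complex.norm_I, one_mul, one_mul]
  have h5 := norm_sub_le (∫ x in l..L, Ψ (x + (d - α : ℝ) * Complex.I))
    (∫ x in l..L, Ψ (x + (d + α : ℝ) * Complex.I))
  nlinarith

/-- Moving the right vertical side of the contour. -/
theorem contourIntegral_eq_of_differentiableOn [CompleteSpace F] {Ψ : ℂ → F} {L' : ℝ} (hl : l ≤ L)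
    (hL : L ≤ L') (hα : 0 ≤ α) (hc : ContinuousOn Ψ (contourSet d α l L))
    (hΨ : DifferentiableOn ℂ Ψ {ζ | ζ.re ∈ Set.Icc L L' ∧ ζ.im ∈ Set.Icc (d - α) (d + α)}) :
    contourIntegral d α l L Ψ = contourIntegral d α l L' Ψ := by
  have hrect := Complex.integral_boundary_rect_eq_zero_of_differentiableOn Ψ
    (L + (d - α : ℝ) * Complex.I) (L' + (d + α : ℝ) * Complex.I) (hΨ.mono (by
      intro ζ hζ
      simp only [Complex.add_re, Complex.ofReal_re, Complex.re_ofReal_mul, Complex.I_re, mul_zero,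
        add_zero, Complex.add_im, Complex.ofReal_im, Complex.im_ofReal_mul, Complex.I_im, mul_one,
        zero_add] at hζ
      rwa [Set.uIcc_of_le hL, Set.uIcc_of_le (by linarith)] at hζ))
  simp only [Complex.add_re, Complex.ofReal_re, Complex.re_ofReal_mul, Complex.I_re, mul_zero,
    add_zero, Complex.add_im, Complex.ofReal_im, Complex.im_ofReal_mul, Complex.I_im, mul_one,
    zero_add] at hrect
  have hint : ∀ s : ℝ, s = d - α ∨ s = d + α →
      IntervalIntegrable (fun x : ℝ => Ψ (x + s * Complex.I)) volume l L ∧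
      IntervalIntegrable (fun x : ℝ => Ψ (x + s * Complex.I)) volume L L' := by
    intro s hs
    constructor
    · refine ContinuousOn.intervalIntegrable (hc.comp (by fun_prop) fun x hx => ?_)
      rw [Set.uIcc_of_le hl] at hx
      rcases hs with rfl | rfl
      exacts [bottom_mem_contourSet hx, top_mem_contourSet hx]
    · refine ContinuousOn.intervalIntegrable (hΨ.continuousOn.comp (by fun_prop) fun x hx => ?_)
      rw [Set.uIcc_of_le hL] at hx
      refine ⟨by simpa using hx, ?_⟩
      rcases hs with rfl | rfl <;> simp <;> linarith
  obtain ⟨hb1, hb2⟩ := hint (d - α) (Or.inl rfl)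
  obtain ⟨ht1, ht2⟩ := hint (d + α) (Or.inr rfl)
  rw [contourIntegral, contourIntegral, ← intervalIntegral.integral_add_adjacent_intervals hb1 hb2,
    ← intervalIntegral.integral_add_adjacent_intervals ht1 ht2]
  congr 2
  rw [← sub_eq_zero, ← neg_eq_zero, ← hrect]
  abel

theorem differentiableOn_intervalIntegral_path [CompleteSpace F] {U S : Set ℂ} (hU : IsOpen U)
    {H : ℂ → ℂ → F} {B : ℝ} (hc : ∀ z ∈ U, ContinuousOn (H z) S)
    (hd : ∀ ζ ∈ S, DifferentiableOn ℂ (fun z => H z ζ) U) (hB : ∀ z ∈ U, ∀ ζ ∈ S, ‖H z ζ‖ ≤ B)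
    {a b : ℝ} (hab : a ≤ b) {γ : ℝ → ℂ} (hγ : Continuous γ) (hS : ∀ y ∈ Set.Icc a b, γ y ∈ S) :
    DifferentiableOn ℂ (fun z => ∫ y in a..b, H z (γ y)) U := by
  simp only [intervalIntegral.integral_of_le hab]
  have hS' : ∀ y ∈ Set.Ioc a b, γ y ∈ S := fun y hy => hS y (Set.Ioc_subset_Icc_self hy)
  refine differentiableOn_integral_of_dominated hU (fun z hz => ?_) ?_ fun z₀ hz₀ =>
    ⟨1, one_pos, fun _ => B, integrable_const B, ?_⟩
  · exact ((hc z hz).comp hγ.continuousOn hS').aestronglyMeasurable measurableSet_Ioc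
  · filter_upwards [ae_restrict_mem measurableSet_Ioc] with y hy using hd _ (hS' y hy)
  · filter_upwards [ae_restrict_mem measurableSet_Ioc] with y hy z hz _ using hB z hz _ (hS' y hy)

theorem differentiableOn_contourIntegral [CompleteSpace F] {U : Set ℂ} (hU : IsOpen U)
    {H : ℂ → ℂ → F} {B : ℝ} (hα : 0 ≤ α) (hαπ : α ≤ Real.pi) (hl : l ≤ L)
    (hc : ∀ z ∈ U, ContinuousOn (H z) (contourSet d α l L))
    (hd : ∀ ζ ∈ contourSet d α l L, DifferentiableOn ℂ (fun z => H z ζ) U)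
    (hB : ∀ z ∈ U, ∀ ζ ∈ contourSet d α l L, ‖H z ζ‖ ≤ B) :
    DifferentiableOn ℂ (fun z => contourIntegral d α l L (H z)) U := by
  have h1 := differentiableOn_intervalIntegral_path hU hc hd hB hl
    (γ := fun x : ℝ => (x + (d - α : ℝ) * Complex.I : ℂ)) (by fun_prop)
    fun x hx => bottom_mem_contourSet hx
  have h2 := differentiableOn_intervalIntegral_path hU hc hd hB hl
    (γ := fun x : ℝ => (x + (d + α : ℝ) * Complex.I : ℂ)) (by fun_prop)
    fun x hx => top_mem_contourSet hx
  have h3 := differentiableOn_intervalIntegral_path hU hc hd hB (by linarith : d - α ≤ d + α)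
    (γ := fun y : ℝ => (L + y * Complex.I : ℂ)) (by fun_prop)
    fun y hy => right_mem_contourSet hy
  have h4 := differentiableOn_intervalIntegral_path hU hc hd hB
    (by linarith : d + α ≤ d - α + 2 * Real.pi)
    (γ := fun y : ℝ => (l + y * Complex.I : ℂ)) (by fun_prop)
    fun y hy => left_mem_contourSet hy
  exact (((h1.sub h2).add (h3.const_smul _)).add (h4.const_smul _)).const_smul _

/-- The degenerate contour is a circle. -/
theorem contourIntegral_self {ρ : ℝ} (hρ : 0 < ρ) {G : ℂ → F}
    (hG : ContinuousOn G (Metric.sphere 0 ρ)) :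
    contourIntegral d α (Real.log ρ) (Real.log ρ) (fun ζ => G (Complex.exp ζ)) =
      (2 * Real.pi * Complex.I : ℂ)⁻¹ • ∮ w in C(0, ρ), w⁻¹ • G w := by
  have hexp : ∀ y : ℝ, Complex.exp (Real.log ρ + y * Complex.I) = circleMap 0 ρ y := by
    intro y
    rw [Complex.exp_add, ← Complex.ofReal_exp, Real.exp_log hρ, circleMap_zero]
  have hcont : Continuous fun y : ℝ => G (circleMap 0 ρ y) :=
    hG.comp_continuous (continuous_circleMap 0 ρ) fun y => circleMap_mem_sphere 0 hρ.le y
  have hper : Function.Periodic (fun y : ℝ => G (circleMap 0 ρ y)) (2 * Real.pi) := fun y => by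
    simp only [periodic_circleMap 0 ρ y]
  rw [contourIntegral, circleIntegral]
  simp only [intervalIntegral.integral_same, sub_zero, zero_add, hexp, deriv_circleMap]
  congr 1
  -- The horizontal sides have vanished, and the vertical ones together cover one period of the
  -- angle.
  rw [← smul_add, intervalIntegral.integral_add_adjacent_intervals
    (hcont.intervalIntegrable _ _) (hcont.intervalIntegrable _ _),
    hper.intervalIntegral_add_eq (d - α) 0, zero_add, ← intervalIntegral.integral_smul]
  refine intervalIntegral.integral_congr fun y _ => ?_
  have hne : circleMap 0 ρ y ≠ 0 := circleMap_ne_center hρ.ne'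
  simp only [smul_smul]
  congr 1
  field_simp

end Contour

/-! ### Multiplication of Taylor coefficients preserves controlled growth -/

section Hadamard

variable {F : Type*} [NormedAddCommGroup F] [NormedSpace ℂ F]

theorem hatSector_mono {d θ θ' r r' : ℝ} (hθ : θ ≤ θ') (hr : r ≤ r') :
    hatSector d θ r ⊆ hatSector d θ' r' :=
  Set.union_subset_union (fun _ hz => ⟨hz.1, hz.2.trans_le (by linarith)⟩)
    (Metric.ball_subset_ball hr)

/-- The integrand of the Hadamard product in the logarithmic plane. -/
noncomputable def hadamardIntegrand (K : ℂ → ℂ) (g : ℂ → F) (n : ℕ) (z ζ : ℂ) : F :=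
  ((Complex.exp ζ)⁻¹ ^ n * K (z * (Complex.exp ζ)⁻¹)) • g (Complex.exp ζ)

/-- On the contour, the quotient `z / w` stays in a set where the kernel is bounded. -/
theorem mul_inv_exp_mem_of_mem_contourSet {d α l L s : ℝ} (hα : 0 < α) (hαπ : α ≤ Real.pi / 2)
    (hl : l ≤ L) {z ζ : ℂ} (hz : z ∈ hatSector d α (Real.exp l * s)) (hzL : ‖z‖ < Real.exp L * s)
    (hζ : ζ ∈ contourSet d α l L) : z * (Complex.exp ζ)⁻¹ ∈ Metric.ball (0 : ℂ) s ∨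
      ∃ v : ℂ, |v.im| ≤ Real.pi - α / 2 ∧ z * (Complex.exp ζ)⁻¹ = -Complex.exp v := by
  have hre : l ≤ ζ.re := by
    rcases hζ with h | h | h
    exacts [h.1.1, h.1 ▸ hl, h.1.ge]
  have hball : ∀ {x : ℝ}, x ≤ ζ.re → ‖z‖ < Real.exp x * s →
      z * (Complex.exp ζ)⁻¹ ∈ Metric.ball (0 : ℂ) s := by
    intro x hx hzx
    have hs : 0 < s := pos_of_mul_pos_right ((norm_nonneg z).trans_lt hzx) (Real.exp_pos x).le
    rw [mem_ball_zero_iff, norm_mul, norm_inv, Complex.norm_exp, ← div_eq_mul_inv,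
      div_lt_iff₀' (Real.exp_pos _)]
    exact hzx.trans_le (by gcongr)
  rcases hz with hz | hz
  · obtain ⟨v, rfl, hv⟩ := exists_exp_of_mem_sector hz
    rw [abs_lt] at hv
    have hexp : ∀ k : ℤ, Complex.exp v * (Complex.exp ζ)⁻¹ =
        -Complex.exp (v - ζ + ((2 * k + 1 : ℤ) * Real.pi : ℝ) * Complex.I) := by
      intro k
      rw [show v - ζ + ((2 * k + 1 : ℤ) * Real.pi : ℝ) * Complex.I =
        v - ζ + Real.pi * Complex.I + k * (2 * Real.pi * Complex.I) by push_cast; ring,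
        Complex.exp_add _ (k * _), Complex.exp_int_mul_two_pi_mul_I, mul_one, Complex.exp_add,
        Complex.exp_pi_mul_I, Complex.exp_sub, div_eq_mul_inv]
      ring
    have him : ∀ k : ℤ, (v - ζ + ((2 * k + 1 : ℤ) * Real.pi : ℝ) * Complex.I).im =
        v.im - ζ.im + (2 * k + 1) * Real.pi := by
      intro k
      rw [Complex.add_im, Complex.sub_im, Complex.mul_I_im, Complex.ofReal_re]
      push_cast
      ring
    have hcase : ∀ k : ℤ, |v.im - ζ.im + (2 * k + 1) * Real.pi| ≤ Real.pi - α / 2 →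
        ∃ v' : ℂ, |v'.im| ≤ Real.pi - α / 2 ∧
          Complex.exp v * (Complex.exp ζ)⁻¹ = -Complex.exp v' := fun k hk =>
      ⟨_, by rwa [him k], hexp k⟩
    -- The argument of `z` is within `α/2` of `d`, hence at distance at least `α/2` from both rays
    -- and from the left side. The odd multiple of `π` which lands in the strip is `-π` for the
    -- lower ray and `π` for the upper ray and the left side. On the right side `|z/w| < s`.
    rcases hζ with ⟨-, h | h⟩ | ⟨h, -⟩ | ⟨-, h⟩
    · refine Or.inr (hcase (-1) ?_)
      rw [h, abs_le]
      push_cast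
      constructor <;> linarith
    · refine Or.inr (hcase 0 ?_)
      rw [h, abs_le]
      push_cast
      constructor <;> linarith
    · exact Or.inl (hball h.ge hzL)
    · refine Or.inr (hcase 0 ?_)
      rw [abs_le]
      push_cast
      constructor <;> linarith [h.1, h.2]
  · exact Or.inl (hball hre (mem_ball_zero_iff.1 hz))

theorem exp_mem_hatSector_of_mem_contourSet {d α l L θ r : ℝ} (hθ : θ ≤ 2 * Real.pi)
    (hα : 0 < α) (hαθ : 2 * α < θ) (hl : Real.exp l < r) {ζ : ℂ} (hζ : ζ ∈ contourSet d α l L) :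
    Complex.exp ζ ∈ hatSector d θ r := by
  rcases hζ with ⟨-, h | h⟩ | ⟨-, h⟩ | ⟨h, -⟩
  · exact Or.inl (exp_mem_sector hθ (by rw [h, abs_lt]; constructor <;> linarith))
  · exact Or.inl (exp_mem_sector hθ (by rw [h, abs_lt]; constructor <;> linarith))
  · exact Or.inl (exp_mem_sector hθ (by rw [abs_lt]; constructor <;> linarith [h.1, h.2]))
  · refine Or.inr ?_
    rwa [mem_ball_zero_iff, Complex.norm_exp, h]

theorem re_mem_Icc_of_mem_contourSet {d α l L : ℝ} (hl : l ≤ L) {ζ : ℂ}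
    (hζ : ζ ∈ contourSet d α l L) : ζ.re ∈ Set.Icc l L := by
  rcases hζ with h | h | h
  exacts [h.1, ⟨h.1 ▸ hl, h.1.le⟩, ⟨h.1.ge, h.1 ▸ hl⟩]

/-- On a circle, the Hadamard product is given by its power series. -/
theorem hasSum_circleIntegral_hadamard [CompleteSpace F] {g : ℂ → F} {b : ℕ → F} {r ρ : ℝ}
    (hρ : 0 < ρ) (hρr : ρ < r) (hg : DifferentiableOn ℂ g (Metric.ball 0 r))
    (hb : ∀ᶠ z : ℂ in 𝓝 0, HasSum (fun p : ℕ => z ^ p • b p) (g z)) {h : ℕ → ℂ} {K : ℂ → ℂ}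
    {s : ℝ} (hK : ∀ x ∈ Metric.ball (0 : ℂ) s, HasSum (fun j => h j * x ^ j) (K x)) (n : ℕ) {z : ℂ}
    (hz : ‖z‖ < ρ * s) :
    HasSum (fun p : ℕ => z ^ p • h p • b (p + n)) ((2 * Real.pi * Complex.I : ℂ)⁻¹ •
      ∮ w in C(0, ρ), w⁻¹ • ((w⁻¹ ^ n * K (z * w⁻¹)) • g w)) := by
  have hgc : ContinuousOn g (Metric.sphere 0 ρ) :=
    hg.continuousOn.mono fun w hw => by
      rw [mem_sphere_zero_iff_norm] at hw
      rwa [mem_ball_zero_iff, hw]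
  obtain ⟨B, hB⟩ := (isCompact_sphere (0 : ℂ) ρ).exists_bound_of_continuousOn hgc
  have hcirc : ∀ y : ℝ, circleMap 0 ρ y ∈ Metric.sphere (0 : ℂ) ρ :=
    fun y => circleMap_mem_sphere 0 hρ.le y
  have hnorm : ∀ y : ℝ, ‖circleMap 0 ρ y‖ = ρ := fun y => mem_sphere_zero_iff_norm.1 (hcirc y)
  have hne : ∀ y : ℝ, circleMap 0 ρ y ≠ 0 := fun y => circleMap_ne_center hρ.ne'
  have hzρ : ‖z‖ / ρ < s := by rwa [div_lt_iff₀' hρ]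
  have hsummable : Summable fun j => ‖h j‖ * (‖z‖ / ρ) ^ j := by
    have := (hK ((‖z‖ / ρ : ℝ) : ℂ) (by
      rwa [mem_ball_zero_iff, Complex.norm_real, Real.norm_of_nonneg (by positivity)])).summable.norm
    refine this.congr fun j => ?_
    rw [norm_mul, norm_pow, Complex.norm_real, Real.norm_of_nonneg (by positivity)]
  have hterm : ∀ p : ℕ, z ^ p • h p • b (p + n) = (2 * Real.pi * Complex.I : ℂ)⁻¹ •
      ∫ y in (0 : ℝ)..2 * Real.pi, deriv (circleMap 0 ρ) y • ((circleMap 0 ρ y)⁻¹ •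
        (((circleMap 0 ρ y)⁻¹ ^ n * (h p * (z * (circleMap 0 ρ y)⁻¹) ^ p)) •
          g (circleMap 0 ρ y))) := by
    intro p
    rw [coeff_eq_circleIntegral hρ hρr hg hb (p + n), circleIntegral, smul_comm (h p),
      smul_comm (z ^ p), ← intervalIntegral.integral_smul, ← intervalIntegral.integral_smul]
    congr 1
    refine intervalIntegral.integral_congr fun y _ => ?_
    simp only [smul_smul]
    congr 1
    rw [mul_pow, pow_add]
    ring
  simp only [hterm]
  refine HasSum.const_smul _ ?_
  rw [circleIntegral]
  refine intervalIntegral.hasSum_integral_of_dominated_convergence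
    (fun p _ => (ρ⁻¹ ^ n * (‖h p‖ * (‖z‖ / ρ) ^ p)) * B) (fun p => ?_) (fun p => ?_) ?_ ?_ ?_
  · refine Continuous.aestronglyMeasurable ?_
    have hinv : Continuous fun y : ℝ => (circleMap 0 ρ y)⁻¹ :=
      (continuous_circleMap 0 ρ).inv₀ hne
    have hgcirc : Continuous fun y : ℝ => g (circleMap 0 ρ y) :=
      hgc.comp_continuous (continuous_circleMap 0 ρ) hcirc
    have hcirc' := continuous_circleMap 0 ρ
    simp only [deriv_circleMap]
    exact (hcirc'.mul continuous_const).smul (hinv.smul (((hinv.pow n).mul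
      (continuous_const.mul ((continuous_const.mul hinv).pow p))).smul hgcirc))
  · refine Eventually.of_forall fun y _ => ?_
    rw [smul_smul, norm_smul, norm_smul, deriv_circleMap, norm_mul, norm_mul, norm_mul, norm_mul,
      norm_pow, norm_pow, norm_mul, norm_inv, hnorm, Complex.norm_I, mul_one,
      mul_inv_cancel₀ hρ.ne', one_mul, ← div_eq_mul_inv ‖z‖ ρ]
    gcongr
    exact hB _ (hcirc y)
  · exact Eventually.of_forall fun y _ => (hsummable.mul_left _).mul_right _
  · exact intervalIntegrable_const
  · refine Eventually.of_forall fun y _ => ?_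
    have hx : z * (circleMap 0 ρ y)⁻¹ ∈ Metric.ball (0 : ℂ) s := by
      rwa [mem_ball_zero_iff, norm_mul, norm_inv, hnorm, ← div_eq_mul_inv]
    exact ((((hK _ hx).mul_left _).smul_const _).const_smul _).const_smul _

/-- Absorbing a linear factor and a translation of the argument into a dilation. -/
theorem RegularWeight.exists_mul_exp_assocFun_add_le {M : ℕ → ℝ} (hM : RegularWeight M)
    {ρ a k : ℝ} (hρ : 0 < ρ) (ha : 0 < a) (hk : 0 < k) : ∃ c k' : ℝ, 0 < c ∧ 0 < k' ∧
      ∀ x : ℝ, 0 ≤ x → (ρ + a * x) * Real.exp (assocFun M ((ρ + a * x) / k)) ≤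
        c * Real.exp (assocFun M (x / k')) := by
  obtain ⟨A, C, hA, hC, h⟩ := hM.exists_mul_exp_assocFun_le
  have hA0 : 0 < A := by linarith
  refine ⟨k * C * Real.exp (assocFun M (A * ((1 + a) * ρ / k))), k / (A * (1 + a)),
    by positivity, by positivity, fun x hx => ?_⟩
  have h1 := h ((ρ + a * x) / k) (by positivity)
  have h2 : Real.exp (assocFun M (A * ((ρ + a * x) / k))) ≤
      Real.exp (assocFun M (A * ((1 + a) * ρ / k))) *
        Real.exp (assocFun M (x / (k / (A * (1 + a))))) := by
    -- The argument `ρ + a x` is at most `(1 + a)` times the larger of `ρ` and `x`. As the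
    -- associated function is nonnegative, the product of the two exponentials dominates either
    -- case.
    rcases le_total x ρ with hxρ | hxρ
    · refine le_trans ?_ (le_mul_of_one_le_right (Real.exp_pos _).le
        (Real.one_le_exp (hM.assocFun_nonneg (by positivity))))
      refine Real.exp_le_exp.2 (hM.assocFun_mono (by positivity) ?_)
      gcongr
      nlinarith
    · refine le_trans ?_ (le_mul_of_one_le_left (Real.exp_pos _).le
        (Real.one_le_exp (hM.assocFun_nonneg (by positivity))))
      refine Real.exp_le_exp.2 (hM.assocFun_mono (by positivity) ?_)
      rw [show x / (k / (A * (1 + a))) = A * ((1 + a) * x / k) by field_simp]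
      gcongr
      nlinarith
  calc (ρ + a * x) * Real.exp (assocFun M ((ρ + a * x) / k))
      = k * ((ρ + a * x) / k * Real.exp (assocFun M ((ρ + a * x) / k))) := by field_simp
    _ ≤ k * (C * (Real.exp (assocFun M (A * ((1 + a) * ρ / k))) *
        Real.exp (assocFun M (x / (k / (A * (1 + a))))))) := by
        refine mul_le_mul_of_nonneg_left (h1.trans ?_) hk.le
        exact mul_le_mul_of_nonneg_left h2 hC.le
    _ = _ := by ring

/-- The convolution with `K` is taken over a keyhole whose outer radius depends on `z`. By Cauchy's
theorem the integral does not depend on that radius. Fixing it locally gives holomorphy, collapsing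
the keyhole to the circle gives the Taylor coefficients, and taking it proportional to `|z|` for
large `z` gives the growth. -/
theorem IsOfGrowth.exists_hadamard [CompleteSpace F] {M : ℕ → ℝ} (hM : RegularWeight M)
    {d θ r : ℝ} {g : ℂ → F} {b : ℕ → F} (hθ0 : 0 < θ) (hθ : θ ≤ 2 * Real.pi) (hr : 0 < r)
    (hg : IsOfGrowth M d θ r g)
    (hb : ∀ᶠ z : ℂ in 𝓝 0, HasSum (fun p : ℕ => z ^ p • b p) (g z)) {h : ℕ → ℂ}
    (hh : ExtendsToSlitPlane h) (n : ℕ) :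
    ∃ (θ₁ r₁ : ℝ) (f : ℂ → F), 0 < θ₁ ∧ θ₁ ≤ 2 * Real.pi ∧ 0 < r₁ ∧ IsOfGrowth M d θ₁ r₁ f ∧
      ∀ᶠ z : ℂ in 𝓝 0, HasSum (fun p : ℕ => z ^ p • h p • b (p + n)) (f z) := by
  obtain ⟨K, r₀, hr₀, hKball, hKslit, hKsum, hKbound⟩ := hh
  obtain ⟨hgd, hggrowth⟩ := hg
  -- The rays at `d ± α` lie inside the sector of opening `3α`, on which the growth bound for `g` is
  -- taken, while `z` is restricted to opening `α`.
  set α := θ / 4 with hα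
  have hα0 : 0 < α := by positivity
  have hαπ : α ≤ Real.pi / 2 := by rw [hα]; linarith
  have hαπ' : α ≤ Real.pi := by linarith [Real.pi_pos]
  set ρ := r / 2 with hρ
  have hρ0 : 0 < ρ := by positivity
  set l := Real.log ρ with hl
  have hexpl : Real.exp l = ρ := Real.exp_log hρ0
  set s := r₀ / 2 with hs
  have hs0 : 0 < s := by positivity
  have hss : s < r₀ := by rw [hs]; linarith
  set V := hatSector d α (ρ * s) with hV
  have hVopen : IsOpen V := isOpen_hatSector d α _ (by linarith [Real.pi_pos])
  obtain ⟨c, k, hc, hk, hgb⟩ := hggrowth (3 * α) (3 * ρ / 2) (by positivity)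
    (by rw [hα]; linarith) (by positivity) (by rw [hρ]; linarith)
  obtain ⟨B₁, hB₁⟩ := (isCompact_closedBall (0 : ℂ) s).exists_bound_of_continuousOn
    (hKball.continuousOn.mono (Metric.closedBall_subset_ball hss))
  obtain ⟨B₂, hB₂⟩ := hKbound (α / 2) (by positivity)
  set B := max (max B₁ B₂) 0 with hBdef
  have hB0 : 0 ≤ B := le_max_right _ _
  have hKd : ∀ x : ℂ, (x ∈ Metric.ball (0 : ℂ) s ∨ ∃ v : ℂ, |v.im| ≤ Real.pi - α / 2 ∧
      x = -Complex.exp v) → DifferentiableAt ℂ K x ∧ ‖K x‖ ≤ B := by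
    rintro x (hx | ⟨v, hv, rfl⟩)
    · exact ⟨(hKball x (Metric.ball_subset_ball hss.le hx)).differentiableAt
        (Metric.isOpen_ball.mem_nhds (Metric.ball_subset_ball hss.le hx)),
        (hB₁ x (Metric.ball_subset_closedBall hx)).trans
          ((le_max_left _ _).trans (le_max_left _ _))⟩
    · refine ⟨?_, (hB₂ v hv).trans ((le_max_right _ _).trans (le_max_left _ _))⟩
      have hopen : IsOpen {x : ℂ | -x ∈ Complex.slitPlane} :=
        Complex.isOpen_slitPlane.preimage continuous_neg
      have hmem : -Complex.exp v ∈ {x : ℂ | -x ∈ Complex.slitPlane} := by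
        have h' := abs_le.1 hv
        simp only [Set.mem_ofPred_eq, neg_neg, Complex.exp_mem_slitPlane]
        rw [(toIocMod_eq_self Real.two_pi_pos).2 (by constructor <;> linarith)]
        intro h''
        linarith
      exact (hKslit _ hmem).differentiableAt (hopen.mem_nhds hmem)
  have hgd' : ∀ w ∈ hatSector d θ r, DifferentiableAt ℂ g w := fun w hw =>
    (hgd w hw).differentiableAt ((isOpen_hatSector d θ r hθ).mem_nhds hw)
  set Φ : ℂ → ℂ → F := hadamardIntegrand K g n with hΦ
  have hΦζ : ∀ z ζ : ℂ, DifferentiableAt ℂ K (z * (Complex.exp ζ)⁻¹) →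
      Complex.exp ζ ∈ hatSector d θ r → DifferentiableAt ℂ (Φ z) ζ := by
    intro z ζ hKz hζ
    have hinv : DifferentiableAt ℂ (fun ζ => (Complex.exp ζ)⁻¹) ζ :=
      Complex.differentiableAt_exp.inv (Complex.exp_ne_zero ζ)
    have h1 : DifferentiableAt ℂ (fun ζ => K (z * (Complex.exp ζ)⁻¹)) ζ :=
      hKz.comp ζ (hinv.const_mul z)
    have h2 : DifferentiableAt ℂ (fun ζ => g (Complex.exp ζ)) ζ :=
      (hgd' _ hζ).comp ζ Complex.differentiableAt_exp
    exact ((hinv.pow n).mul h1).smul h2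
  have hΦz : ∀ z ζ : ℂ, DifferentiableAt ℂ K (z * (Complex.exp ζ)⁻¹) →
      DifferentiableAt ℂ (fun z => Φ z ζ) z := by
    intro z ζ hKz
    have h1 : DifferentiableAt ℂ (fun z => K (z * (Complex.exp ζ)⁻¹)) z :=
      hKz.comp z (differentiableAt_id.mul_const _)
    exact (h1.const_mul _).smul_const _
  have hmemK : ∀ {L : ℝ}, l ≤ L → ∀ z ∈ V, ‖z‖ < Real.exp L * s → ∀ ζ ∈ contourSet d α l L,
      DifferentiableAt ℂ K (z * (Complex.exp ζ)⁻¹) ∧ ‖K (z * (Complex.exp ζ)⁻¹)‖ ≤ B :=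
    fun {L} hL z hz hzL ζ hζ => hKd _ (mul_inv_exp_mem_of_mem_contourSet hα0 hαπ hL
      (by rwa [hexpl]) hzL hζ)
  have hmemg : ∀ {L : ℝ}, ∀ ζ ∈ contourSet d α l L,
      Complex.exp ζ ∈ hatSector d (3 * α) (3 * ρ / 2) := fun {L} ζ hζ =>
    exp_mem_hatSector_of_mem_contourSet (by rw [hα]; linarith) hα0 (by linarith)
      (by rw [hexpl]; linarith) hζ
  have hsub : hatSector d (3 * α) (3 * ρ / 2) ⊆ hatSector d θ r :=
    hatSector_mono (by rw [hα]; linarith) (by rw [hρ]; linarith)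
  set N : ℝ → ℝ := fun R => ρ⁻¹ ^ n * B * (c * Real.exp (assocFun M (R / k))) with hN
  have hΦB : ∀ {L : ℝ}, l ≤ L → ∀ z ∈ V, ‖z‖ < Real.exp L * s → ∀ ζ ∈ contourSet d α l L,
      ‖Φ z ζ‖ ≤ N (Real.exp L) := by
    intro L hL z hz hzL ζ hζ
    have hre := re_mem_Icc_of_mem_contourSet hL hζ
    have h1 := hgb _ (hmemg ζ hζ)
    rw [Complex.norm_exp] at h1
    have h2 : assocFun M (Real.exp ζ.re / k) ≤ assocFun M (Real.exp L / k) :=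
      hM.assocFun_mono (by positivity) (by have := hre.2; gcongr)
    have h3 : (Real.exp ζ.re)⁻¹ ≤ ρ⁻¹ := by
      have := Real.exp_le_exp.2 hre.1
      rw [hexpl] at this
      gcongr
    rw [hΦ, hadamardIntegrand, norm_smul, norm_mul, norm_pow, norm_inv, Complex.norm_exp]
    have h4 := (hmemK hL z hz hzL ζ hζ).2
    simp only [hN]
    gcongr
    exact h1.trans (by gcongr)
  have hΦc : ∀ {L : ℝ}, l ≤ L → ∀ z ∈ V, ‖z‖ < Real.exp L * s →
      ContinuousOn (Φ z) (contourSet d α l L) := fun {L} hL z hz hzL ζ hζ =>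
    (hΦζ z ζ (hmemK hL z hz hzL ζ hζ).1 (hsub (hmemg ζ hζ))).continuousAt.continuousWithinAt
  have hmove : ∀ {L L' : ℝ}, l ≤ L → L ≤ L' → ∀ z ∈ V, ‖z‖ < Real.exp L * s →
      contourIntegral d α l L (Φ z) = contourIntegral d α l L' (Φ z) := by
    intro L L' hL hLL' z hz hzL
    refine contourIntegral_eq_of_differentiableOn hL hLL' hα0.le (hΦc hL z hz hzL) fun ζ hζ =>
      (hΦζ z ζ (hKd _ (Or.inl ?_)).1 ?_).differentiableWithinAt
    · rw [mem_ball_zero_iff, norm_mul, norm_inv, Complex.norm_exp, ← div_eq_mul_inv,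
        div_lt_iff₀' (Real.exp_pos _)]
      have := hζ.1.1
      exact hzL.trans_le (by gcongr)
    · refine Or.inl (exp_mem_sector hθ ?_)
      rw [abs_lt]
      constructor <;> linarith [hζ.2.1, hζ.2.2]
  -- The outer radius is at least `ρ` and exceeds `‖z‖ / s`, so on the outer arc `z / w` stays in
  -- the disc where `K` is bounded.
  set R : ℂ → ℝ := fun z => ρ + s⁻¹ * ‖z‖ with hR
  have hRρ : ∀ z, ρ ≤ R z := fun z => le_add_of_nonneg_right (by positivity)
  have hR0 : ∀ z, 0 < R z := fun z => hρ0.trans_le (hRρ z)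
  have hlR : ∀ z, l ≤ Real.log (R z) := fun z => Real.log_le_log hρ0 (hRρ z)
  have hzR : ∀ z, ‖z‖ < Real.exp (Real.log (R z)) * s := by
    intro z
    rw [Real.exp_log (hR0 z), hR, add_mul, mul_right_comm, inv_mul_cancel₀ hs0.ne', one_mul]
    exact lt_add_of_pos_left _ (by positivity)
  set f : ℂ → F := fun z => contourIntegral d α l (Real.log (R z)) (Φ z) with hf
  refine ⟨α, ρ * s, f, hα0, by linarith [Real.pi_pos], by positivity, ⟨?_, ?_⟩, ?_⟩
  · intro z₀ hz₀
    -- One outer radius valid for all `z` near `z₀`; the radius `R z` itself is not holomorphic in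
    -- `z`.
    set L := Real.log (R z₀ + 1) with hL
    have hRcont : Continuous R := by fun_prop
    set U := V ∩ {z | R z < R z₀ + 1} with hU
    have hUopen : IsOpen U := hVopen.inter (isOpen_lt hRcont continuous_const)
    have hz₀U : z₀ ∈ U := ⟨hz₀, lt_add_one (R z₀)⟩
    have hlog : ∀ z ∈ U, Real.log (R z) ≤ L := fun z hz =>
      Real.log_le_log (hR0 z) (le_of_lt hz.2)
    have hlL : l ≤ L := (hlR z₀).trans (hlog z₀ hz₀U)
    have hzL : ∀ z ∈ U, ‖z‖ < Real.exp L * s := fun z hz =>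
      (hzR z).trans_le (by have := hlog z hz; gcongr)
    have hdiff : DifferentiableOn ℂ (fun z => contourIntegral d α l L (Φ z)) U :=
      differentiableOn_contourIntegral hUopen hα0.le hαπ' hlL
        (fun z hz => hΦc hlL z hz.1 (hzL z hz))
        (fun ζ hζ z hz =>
          (hΦz z ζ (hmemK hlL z hz.1 (hzL z hz) ζ hζ).1).differentiableWithinAt)
        (fun z hz => hΦB hlL z hz.1 (hzL z hz))
    have hfd : DifferentiableOn ℂ f U := hdiff.congr fun z hz =>
      hmove (hlR z) (hlog z hz) z hz.1 (hzR z)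
    exact ((hfd z₀ hz₀U).differentiableAt (hUopen.mem_nhds hz₀U)).differentiableWithinAt
  · intro θ' r' _ hθ' _ hr'
    obtain ⟨c', k', hc', hk', habs⟩ :=
      hM.exists_mul_exp_assocFun_add_le hρ0 (inv_pos.2 hs0) hk
    refine ⟨(2 * ρ⁻¹ + 2 * Real.pi * ρ⁻¹) * (ρ⁻¹ ^ n * (B + 1) * c) * c', k',
      by positivity, hk', fun z hz => ?_⟩
    have hzV : z ∈ V := hatSector_mono hθ'.le hr'.le hz
    have h1 := norm_contourIntegral_le hα0.le hαπ' (hlR z) (hΦB (hlR z) z hzV (hzR z))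
    rw [Real.exp_log (hR0 z)] at h1
    -- The length of the contour in the logarithmic plane is only logarithmic in `R z`. The cruder
    -- linear bound is what `exists_mul_exp_assocFun_add_le` absorbs.
    have h2 : 2 * (Real.log (R z) - l) + 2 * Real.pi ≤
        (2 * ρ⁻¹ + 2 * Real.pi * ρ⁻¹) * R z := by
      have h3 : Real.log (R z) - l ≤ ρ⁻¹ * R z := by
        rw [hl, ← Real.log_div (hR0 z).ne' hρ0.ne', ← div_eq_inv_mul]
        exact Real.log_le_self (by have := hR0 z; positivity)
      have h4 : 1 ≤ ρ⁻¹ * R z := by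
        rw [← div_eq_inv_mul, one_le_div hρ0]
        exact hRρ z
      nlinarith [Real.pi_pos]
    have h5 : N (R z) ≤ ρ⁻¹ ^ n * (B + 1) * c * Real.exp (assocFun M (R z / k)) := by
      simp only [hN]
      rw [← mul_assoc]
      gcongr
      linarith
    have hN0 : 0 ≤ N (R z) := by simp only [hN]; positivity
    have hRz := hR0 z
    calc ‖f z‖ ≤ (2 * (Real.log (R z) - l) + 2 * Real.pi) * N (R z) := h1
      _ ≤ ((2 * ρ⁻¹ + 2 * Real.pi * ρ⁻¹) * R z) *
          (ρ⁻¹ ^ n * (B + 1) * c * Real.exp (assocFun M (R z / k))) :=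
          mul_le_mul h2 h5 hN0 (by positivity)
      _ = (2 * ρ⁻¹ + 2 * Real.pi * ρ⁻¹) * (ρ⁻¹ ^ n * (B + 1) * c) *
          (R z * Real.exp (assocFun M (R z / k))) := by ring
      _ ≤ (2 * ρ⁻¹ + 2 * Real.pi * ρ⁻¹) * (ρ⁻¹ ^ n * (B + 1) * c) *
          (c' * Real.exp (assocFun M (‖z‖ / k'))) := by
          have := habs ‖z‖ (norm_nonneg z)
          gcongr
      _ = _ := by ring
  · filter_upwards [Metric.ball_mem_nhds (0 : ℂ) (by positivity : 0 < ρ * s)] with z hz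
    have hzρ : ‖z‖ < ρ * s := mem_ball_zero_iff.1 hz
    have hρr : ρ < r := by rw [hρ]; linarith
    have hsum := hasSum_circleIntegral_hadamard hρ0 hρr
      (hgd.mono Set.subset_union_right) hb
      (fun x hx => hKsum x (Metric.ball_subset_ball hss.le hx)) n hzρ
    have hcont : ContinuousOn (fun w : ℂ => (w⁻¹ ^ n * K (z * w⁻¹)) • g w)
        (Metric.sphere 0 ρ) := by
      intro w hw
      have hwρ := mem_sphere_zero_iff_norm.1 hw
      have hw0 : w ≠ 0 := norm_pos_iff.1 (hwρ ▸ hρ0)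
      have hzw : z * w⁻¹ ∈ Metric.ball (0 : ℂ) s := by
        rwa [mem_ball_zero_iff, norm_mul, norm_inv, hwρ, ← div_eq_mul_inv, div_lt_iff₀' hρ0]
      have hinv : ContinuousAt (fun w : ℂ => w⁻¹) w := continuousAt_inv₀ hw0
      have h1 : ContinuousAt (fun w => K (z * w⁻¹)) w :=
        ContinuousAt.comp (f := fun w : ℂ => z * w⁻¹) (g := K)
          (hKd _ (Or.inl hzw)).1.continuousAt (hinv.const_mul z)
      have h2 : ContinuousAt g w :=
        (hgd' w (Or.inr (by rwa [mem_ball_zero_iff, hwρ]))).continuousAt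
      exact (((hinv.pow n).mul h1).smul h2).continuousWithinAt
    have heq : f z = (2 * Real.pi * Complex.I : ℂ)⁻¹ •
        ∮ w in C(0, ρ), w⁻¹ • ((w⁻¹ ^ n * K (z * w⁻¹)) • g w) := by
      rw [← contourIntegral_self (d := d) (α := α) hρ0 hcont]
      exact (hmove le_rfl (hlR z) z (Or.inr hz) (by rwa [hexpl])).symm
    rwa [heq]

end Hadamard

/-! ### Closure under moment differentiation -/

theorem IsMomentSequenceFor.ne_zero {M : ℕ → ℝ} {m : ℕ → ℂ} (hm : IsMomentSequenceFor M m)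
    (p : ℕ) : m p ≠ 0 := by
  obtain ⟨q, e, E, -, hk, hmq⟩ := hm
  rw [hmq]
  exact_mod_cast hk.moment_ne_zero (q * p)

theorem momentDeriv_mem_summableSeriesWith {F : Type*} [NormedAddCommGroup F] [NormedSpace ℂ F]
    [CompleteSpace F] {m : ℕ → ℂ} (hm : IsMomentSequence m) {M : ℕ → ℝ} (hM : StronglyRegular M)
    {m' : ℕ → ℂ} (hm' : IsMomentSequenceFor M m') {d : ℝ} {a : ℕ → F}
    (ha : a ∈ summableSeriesWith F M m' d) : momentDeriv m a ∈ summableSeriesWith F M m' d := by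
  obtain ⟨M₀, hM₀, hm₀⟩ := hm
  obtain ⟨θ, r, g, hθ0, hθ, hr, hg, hb⟩ := ha
  -- The first product carries the shift by one and the quotients of `m`. The second, without shift,
  -- carries the quotients of `m'` and corrects `1 / m'(p+1)` to `1 / m'(p)`.
  obtain ⟨θ₁, r₁, g₁, hθ₁0, hθ₁, hr₁, hg₁, hb₁⟩ := hg.exists_hadamard hM.regularWeight hθ0 hθ hr hb
    (hm₀.extendsToSlitPlane hM₀.regularWeight) 1
  obtain ⟨θ₂, r₂, g₂, hθ₂0, hθ₂, hr₂, hg₂, hb₂⟩ := hg₁.exists_hadamard hM.regularWeight hθ₁0 hθ₁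
    hr₁ hb₁ (hm'.extendsToSlitPlane hM.regularWeight) 0
  refine ⟨θ₂, r₂, g₂, hθ₂0, hθ₂, hr₂, hg₂, ?_⟩
  filter_upwards [hb₂] with z hz
  convert hz using 3 with p
  simp only [borel, momentDeriv, add_zero, smul_smul]
  congr 1
  have h1 := hm'.ne_zero (p + 1)
  field_simp

end MomentSummability

/-- The space of `M`-summable series in direction `d` is closed under `m`-moment differentiation,
for every sequence of moments `m`; more precisely, so is the space obtained from each single
kernel for `M`-summability (with sequence of moments `m'`). -/
theorem corollary3p12 {F : Type*} [NormedAddCommGroup F] [NormedSpace ℂ F] [CompleteSpace F]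
    (m : ℕ → ℂ) (hm : MomentSummability.IsMomentSequence m)
    (M : ℕ → ℝ) (hM : MomentSummability.StronglyRegular M)
    (hM' : MomentSummability.AdmitsNonzeroProximateOrder M) (d : ℝ) :
    (∀ a ∈ MomentSummability.summableSeries F M d,
      MomentSummability.momentDeriv m a ∈ MomentSummability.summableSeries F M d) ∧
    (∀ m' : ℕ → ℂ, MomentSummability.IsMomentSequenceFor M m' →
      ∀ a ∈ MomentSummability.summableSeriesWith F M m' d,
        MomentSummability.momentDeriv m a ∈ MomentSummability.summableSeriesWith F M m' d) := by
  refine ⟨?_, fun m' hm' a ha => MomentSummability.momentDeriv_mem_summableSeriesWith hm hM hm' ha⟩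
  rintro a ⟨m', hm', ha⟩
  exact ⟨m', hm', MomentSummability.momentDeriv_mem_summableSeriesWith hm hM hm' ha⟩
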